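/- Let $p$ be an odd prime and let $G$ be a finite $p$-group of coclass $2$, that is, $|G| = p^n$ and $G$ has nilpotency class $c$ with $n - c = 2$. Then $G$ has a non-inner automorphism of order $p$: there is an automorphism $\varphi$ of $G$ whose order is exactly $p$ and which is not of the form $x \mapsto g x g^{-1}$ for any $g \in G$. -/

import Mathlib

/-- A finite group `G` of order `p ^ n` and nilpotency class `c` has coclass `r` when
`r = n - c`; this is written additively as `n = c + r`, so that no truncated subtraction occurs.
For `p` prime such a `G` is automatically nilpotent, so `Group.nilpotencyClass` is the true class. -/
def HasCoclass (p : ℕ) (G : Type*) [Group G] (r : ℕ) : Prop :=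
  ∃ n : ℕ, Nat.card G = p ^ n ∧ n = Group.nilpotencyClass G + r

/-- An automorphism is inner when it is conjugation by some element of the group. -/
def IsInnerAut {G : Type*} [Group G] (φ : MulAut G) : Prop :=
  ∃ g : G, ∀ x : G, φ x = g * x * g⁻¹

/-! Suppose every automorphism of order `p` is inner. A crossed homomorphism `δ` that is trivial on
its own values and has values of order dividing `p` gives an automorphism `x ↦ x * δ x`, so each
nontrivial such `δ` must come from a conjugating element. The proof builds enough of them to reach a
contradiction. Write `Z i` for the upper central series and `c` for the class.

For `c ≤ 2` one derivation suffices: a homomorphism into a central subgroup of order `p`, the map `x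
↦ x ^ p`, or the derivation attached to a noncentral `v` of order `p`.

For `c ≥ 3`, homomorphisms to `ZMod p` killing a central `z` of order `p` give conjugating elements
in `Z 2`, distinct modulo the center. As `G ⧸ Z (c - 1)` is not cyclic, there are at least `p ^ 2`
of them. Coclass 2 leaves no slack, so `Z 1` has order `p`, `Z i` has order `p ^ (i + 1)` for `2 ≤ i
< c`, and every homomorphism to `ZMod p` killing `z` kills `Z (c - 1)`
(`card_upperCentralSeries_of_coclass_two`). Some noncentral `v` in `Z 2` has order `p`, and `x⁻¹ * v
* x = v * z ^ χ x` defines a character `χ`. A quadratic correction turns `v ^ χ` into a derivation,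
induced by some `a` in `Z 3` outside `Z 2` (`exists_conj_of_character`).

If `c = 3`, the element `a` forces `G ⧸ ⟨v, Z 1⟩` to be elementary abelian, which gives a
homomorphism nontrivial on `Z 2` and killing `z`. If `c ≥ 4`, a second derivation, built on the
kernel of `χ` and extended to `G`, is induced by another element of `Z 3`. Since `Z 3 ⧸ Z 2` has
order `p`, this element is a power of `a` modulo `Z 2`, which contradicts the values of the second
derivation on `ker χ`. -/

open scoped commutatorElement

/-! ### Automorphisms of order `p` from crossed homomorphisms -/

section Automorphisms

variable {G : Type*} [Group G]

/-- A crossed homomorphism `δ` with values of order dividing `p` and vanishing on its own values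
induces the automorphism `g ↦ g * δ g` of order `p`. -/
theorem exists_mulAut_of_derivation {p : ℕ} (hp : p.Prime) (δ : G → G)
    (hmul : ∀ g h, δ (g * h) = h⁻¹ * δ g * h * δ h) (hδδ : ∀ g, δ (δ g) = 1)
    (hpow : ∀ g, δ g ^ p = 1) (hne : ∃ g, δ g ≠ 1) :
    ∃ φ : MulAut G, orderOf φ = p ∧ ∀ g, φ g = g * δ g := by
  let f : G →* G := MonoidHom.mk' (fun g => g * δ g) fun g h => by rw [hmul]; group
  have hf : ∀ g, f g = g * δ g := fun _ => rfl
  -- The values of `δ` are fixed by `f`, so iterating `f` only accumulates powers of `δ g`.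
  have hfδ : ∀ g (k : ℕ), f (δ g ^ k) = δ g ^ k := fun g k => by
    rw [map_pow, hf, hδδ, mul_one]
  have hiter : ∀ (k : ℕ) g, f^[k] g = g * δ g ^ k := by
    intro k
    induction k with
    | zero => simp
    | succ k ih =>
      intro g
      rw [Function.iterate_succ_apply', ih, map_mul, hfδ, hf, mul_assoc, pow_succ']
  have hfp : ∀ g, f^[p] g = g := fun g => by rw [hiter, hpow, mul_one]
  obtain ⟨m, rfl⟩ : ∃ m, p = m + 1 := ⟨p - 1, (Nat.succ_pred_eq_of_pos hp.pos).symm⟩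
  let φ : MulAut G :=
    { f with
      invFun := f^[m]
      left_inv := fun g => by
        have := hfp g
        rwa [Function.iterate_succ_apply] at this
      right_inv := fun g => by
        have := hfp g
        rwa [Function.iterate_succ_apply'] at this }
  have hφ : ∀ g, φ g = f g := fun _ => rfl
  have hφk : ∀ (k : ℕ) g, (φ ^ k) g = f^[k] g := by
    intro k
    induction k with
    | zero => simp
    | succ k ih => intro g; rw [pow_succ', MulAut.mul_apply, ih, hφ, Function.iterate_succ_apply']
  refine ⟨φ, ?_, fun g => rfl⟩
  have : Fact (m + 1).Prime := ⟨hp⟩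
  apply orderOf_eq_prime
  · ext g
    rw [hφk, hfp, MulAut.one_apply]
  · rintro h1
    obtain ⟨g, hg⟩ := hne
    apply hg
    have := congrArg (fun ψ : MulAut G => ψ g) h1
    simpa [hφ, hf] using this

theorem exists_conj_of_derivation {p : ℕ} (hp : p.Prime)
    (hinn : ∀ φ : MulAut G, orderOf φ = p → IsInnerAut φ) (δ : G → G)
    (hmul : ∀ g h, δ (g * h) = h⁻¹ * δ g * h * δ h) (hδδ : ∀ g, δ (δ g) = 1)
    (hpow : ∀ g, δ g ^ p = 1) (hne : ∃ g, δ g ≠ 1) :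
    ∃ a : G, ∀ x, a * x * a⁻¹ = x * δ x := by
  obtain ⟨φ, hφ, hφδ⟩ := exists_mulAut_of_derivation hp δ hmul hδδ hpow hne
  obtain ⟨a, ha⟩ := hinn φ hφ
  exact ⟨a, fun x => by rw [← ha, hφδ]⟩

end Automorphisms

/-! ### Powers of a product with central commutator -/

section PowerFormula

variable {G : Type*} [Group G]

theorem mul_pow_of_commutator_central {a b z : G} (h : b * a = a * b * z) (hza : Commute z a)
    (hzb : Commute z b) (n : ℕ) : (a * b) ^ n = a ^ n * b ^ n * z ^ n.choose 2 := by
  have hba : ∀ n : ℕ, b ^ n * a = a * b ^ n * z ^ n := by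
    intro n
    induction n with
    | zero => simp
    | succ n ih =>
      have e : z * b ^ n = b ^ n * z := (hzb.pow_right n).eq
      calc b ^ (n + 1) * a = b ^ n * (b * a) := by rw [pow_succ, mul_assoc]
        _ = b ^ n * a * (b * z) := by rw [h]; group
        _ = a * b ^ n * (z ^ n * b) * z := by rw [ih]; group
        _ = a * b ^ n * (b * z ^ n) * z := by rw [(hzb.pow_left n).eq]
        _ = a * b ^ (n + 1) * z ^ (n + 1) := by rw [pow_succ b, pow_succ z]; group
  induction n with
  | zero => simp
  | succ n ih =>
    rw [pow_succ, ih, Nat.choose_succ_succ' n 1, Nat.choose_one_right, pow_add z]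
    calc a ^ n * b ^ n * z ^ n.choose 2 * (a * b)
        = a ^ n * b ^ n * (z ^ n.choose 2 * (a * b)) := by group
      _ = a ^ n * b ^ n * ((a * b) * z ^ n.choose 2) := by
          rw [((hza.mul_right hzb).pow_left _).eq]
      _ = a ^ n * (b ^ n * a) * b * z ^ n.choose 2 := by group
      _ = a ^ n * a * b ^ n * (z ^ n * b) * z ^ n.choose 2 := by rw [hba]; group
      _ = a ^ n * a * b ^ n * (b * z ^ n) * z ^ n.choose 2 := by rw [(hzb.pow_left n).eq]
      _ = a ^ (n + 1) * b ^ (n + 1) * (z ^ n * z ^ n.choose 2) := by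
          rw [pow_succ a, pow_succ b]; group

theorem mul_pow_prime_of_commutator_central {p : ℕ} (hp : p.Prime) (hodd : Odd p) {a b z : G}
    (h : b * a = a * b * z) (hza : Commute z a) (hzb : Commute z b) (hz : z ^ p = 1) :
    (a * b) ^ p = a ^ p * b ^ p := by
  have h2 : 2 < p := by
    rcases hp.two_le.lt_or_eq with h | h
    · exact h
    · subst h; exact absurd hodd (by decide)
  obtain ⟨k, hk⟩ := hp.dvd_choose_self (k := 2) (by norm_num) h2
  rw [mul_pow_of_commutator_central h hza hzb, hk, pow_mul, hz, one_pow, mul_one]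

end PowerFormula

/-! ### Exponents in `ZMod p` -/

section ModularPower

variable {G : Type*} [Group G] {p : ℕ}

/-- The power `z ^ a` with exponent `a` modulo `p`, meaningful when `z ^ p = 1`. -/
def modPow (z : G) (a : ZMod p) : G := z ^ a.val

theorem modPow_pow {z : G} (hz : z ^ p = 1) (a : ZMod p) : modPow z a ^ p = 1 := by
  rw [modPow, ← pow_mul, mul_comm, pow_mul, hz, one_pow]

theorem modPow_mem {H : Subgroup G} {z : G} (hz : z ∈ H) (a : ZMod p) : modPow z a ∈ H :=
  H.pow_mem hz _

theorem commute_modPow {z g : G} (h : Commute z g) (a : ZMod p) : Commute (modPow z a) g :=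
  h.pow_left _

theorem conj_modPow (z g : G) (a : ZMod p) : g⁻¹ * modPow z a * g = modPow (g⁻¹ * z * g) a := by
  have := conj_pow (i := a.val) (a := g⁻¹) (b := z)
  rw [inv_inv] at this
  exact this.symm

theorem modPow_mul_base {v z : G} (h : Commute v z) (a : ZMod p) :
    modPow (v * z) a = modPow v a * modPow z a :=
  h.mul_pow _

variable [Fact p.Prime]

theorem modPow_natCast {z : G} (hz : z ^ p = 1) (n : ℕ) : modPow z (n : ZMod p) = z ^ n := by
  rw [modPow, ZMod.val_natCast, ← pow_eq_pow_mod n hz]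

theorem modPow_add {z : G} (hz : z ^ p = 1) (a b : ZMod p) :
    modPow z (a + b) = modPow z a * modPow z b := by
  conv_lhs => rw [← ZMod.natCast_zmod_val a, ← ZMod.natCast_zmod_val b]
  rw [← Nat.cast_add, modPow_natCast hz, pow_add]
  rfl

theorem modPow_zero (z : G) : modPow z (0 : ZMod p) = 1 := by
  simp [modPow]

theorem modPow_one {z : G} : modPow z (1 : ZMod p) = z := by
  rw [modPow, ZMod.val_one'' (Fact.out : p.Prime).ne_one, pow_one]

theorem modPow_mul {z : G} (hz : z ^ p = 1) (a b : ZMod p) :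
    modPow z (a * b) = modPow (modPow z a) b := by
  conv_lhs => rw [← ZMod.natCast_zmod_val a, ← ZMod.natCast_zmod_val b]
  rw [← Nat.cast_mul, modPow_natCast hz, pow_mul]
  rfl

theorem mem_of_modPow_mem {H : Subgroup G} {z : G} (hz : z ^ p = 1) {a : ZMod p} (ha : a ≠ 0)
    (h : modPow z a ∈ H) : z ∈ H := by
  have := modPow_mem (p := p) h a⁻¹
  rwa [← modPow_mul hz, mul_inv_cancel₀ ha, modPow_one] at this

theorem modPow_inj {z : G} (hz : orderOf z = p) {a b : ZMod p} :
    modPow z a = modPow z b ↔ a = b := by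
  refine ⟨fun h => ?_, fun h => h ▸ rfl⟩
  have := pow_injOn_Iio_orderOf (x := z) (by simp [hz, ZMod.val_lt])
    (by simp [hz, ZMod.val_lt]) h
  exact ZMod.val_injective p this

theorem exists_modPow_of_mem_zpowers {z g : G} (hz : orderOf z = p) (hg : g ∈ Subgroup.zpowers z) :
    ∃ a : ZMod p, g = modPow z a := by
  have hfin : IsOfFinOrder z := orderOf_pos_iff.mp (hz ▸ (Fact.out : p.Prime).pos)
  obtain ⟨n, rfl⟩ := hfin.mem_powers_iff_mem_zpowers.mpr hg
  exact ⟨n, (modPow_natCast (hz ▸ pow_orderOf_eq_one z) n).symm⟩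

end ModularPower

/-! ### Homomorphisms to the group of order `p` -/

section Homs

/-- A proper subgroup of a finite `p`-group lies in one of index `p`, which is normal because `p` is
the least prime factor of the group order. -/
theorem exists_hom_ker_ge {p : ℕ} [hp : Fact p.Prime] {G : Type*} [Group G] [Finite G]
    (hG : IsPGroup p G) {H : Subgroup G} (hH : H ≠ ⊤) :
    ∃ f : G →* Multiplicative (ZMod p), H ≤ f.ker ∧ f ≠ 1 := by
  obtain ⟨n, hn⟩ := IsPGroup.iff_card.mp hG
  obtain ⟨k, hk⟩ := IsPGroup.iff_card.mp (hG.to_subgroup H)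
  have hkn : k < n := by
    have h1 : Nat.card H < Nat.card G := by
      refine lt_of_le_of_ne (Nat.card_le_card_of_injective _ H.subtype_injective) fun h => hH ?_
      exact Subgroup.eq_top_of_card_eq H h
    rw [hk, hn] at h1
    exact (Nat.pow_lt_pow_iff_right hp.out.one_lt).mp h1
  obtain ⟨m, rfl⟩ : ∃ m, n = m + 1 := ⟨n - 1, by omega⟩
  obtain ⟨K, hK, hHK⟩ := Sylow.exists_subgroup_card_pow_prime_le p
    (m := m) (n := k) (by rw [hn]; exact pow_dvd_pow p (Nat.le_succ m)) H hk (by omega)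
  have hidx : K.index = p := by
    have h := K.card_mul_index
    rw [hK, hn, pow_succ] at h
    exact Nat.eq_of_mul_eq_mul_left (pow_pos hp.out.pos m) h
  have hKn : K.Normal := by
    apply Subgroup.normal_of_index_eq_minFac_card
    rw [hidx, hn, Nat.pow_minFac (Nat.succ_ne_zero m), hp.out.minFac_eq]
  have hc : Nat.card (G ⧸ K) = p := hidx
  let e : G ⧸ K ≃* Multiplicative (ZMod p) := mulEquivOfPrimeCardEq (p := p) hc (by simp)
  refine ⟨e.toMonoidHom.comp (QuotientGroup.mk' K), fun x hx => ?_, fun h => ?_⟩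
  · rw [MonoidHom.mem_ker]
    simpa using hHK hx
  · have hKtop : K = ⊤ := by
      ext x
      simp only [Subgroup.mem_top, iff_true]
      rw [← QuotientGroup.eq_one_iff]
      have := DFunLike.congr_fun h x
      simpa using this
    rw [hKtop, Subgroup.index_top] at hidx
    exact hp.out.one_lt.ne hidx

theorem exists_addHom_apply_ne_zero {p : ℕ} [Fact p.Prime] {A : Type*} [AddCommGroup A]
    [Module (ZMod p) A] {u : A} (hu : u ≠ 0) : ∃ f : A →+ ZMod p, f u ≠ 0 := by
  have : Module.Projective (ZMod p) A := inferInstance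
  by_contra! hf
  exact hu ((Module.forall_dual_apply_eq_zero_iff (ZMod p) u).mp fun φ => hf φ.toAddMonoidHom)

theorem exists_hom_apply_ne_one {p : ℕ} [Fact p.Prime] {A : Type*} [Group A]
    (hcomm : ∀ x y : A, x * y = y * x) (hpow : ∀ x : A, x ^ p = 1) {u : A} (hu : u ≠ 1) :
    ∃ f : A →* Multiplicative (ZMod p), f u ≠ 1 := by
  let _ : CommGroup A := { ‹Group A› with mul_comm := hcomm }
  let _ : Module (ZMod p) (Additive A) := AddCommGroup.zmodModule fun x => hpow x.toMul
  obtain ⟨f, hf⟩ := exists_addHom_apply_ne_zero (p := p) (u := Additive.ofMul u) hu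
  exact ⟨AddMonoidHom.toMultiplicativeRight f, hf⟩

end Homs

/-! ### Relative centers and small indices in `p`-groups -/

section Subgroups

variable {G : Type*} [Group G]

theorem commutator_mem_iff_commute_mk {N : Subgroup G} [N.Normal] {x y : G} :
    ⁅x, y⁆ ∈ N ↔ Commute (x : G ⧸ N) (y : G ⧸ N) := by
  rw [← QuotientGroup.eq_one_iff, ← commutatorElement_eq_one_iff_commute]
  rfl

/-- The preimage in `G` of the center of `G ⧸ N`. -/
def centerMod (N : Subgroup G) [N.Normal] : Subgroup G :=
  (Subgroup.center (G ⧸ N)).comap (QuotientGroup.mk' N)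

instance (N : Subgroup G) [N.Normal] : (centerMod N).Normal :=
  inferInstanceAs ((Subgroup.center (G ⧸ N)).comap (QuotientGroup.mk' N)).Normal

theorem mem_centerMod_iff {N : Subgroup G} [N.Normal] {x : G} :
    x ∈ centerMod N ↔ ∀ y, ⁅x, y⁆ ∈ N := by
  simp only [commutator_mem_iff_commute_mk]
  rw [centerMod, Subgroup.mem_comap, Subgroup.mem_center_iff]
  refine ⟨fun h y => (h y).symm, fun h y => ?_⟩
  obtain ⟨y, rfl⟩ := QuotientGroup.mk_surjective y
  exact (h y).symm

/-- A group that is cyclic modulo its center is abelian, applied to `G ⧸ N`. -/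
theorem commutator_mem_of_centerMod_cyclic {N : Subgroup G} [N.Normal] {a : G}
    (h : ∀ g, ∃ k : ℤ, ∃ t ∈ centerMod N, g = a ^ k * t) (x y : G) : ⁅x, y⁆ ∈ N := by
  have hc : ∀ t ∈ centerMod N, ∀ g : G, Commute (t : G ⧸ N) (g : G ⧸ N) := fun t ht g =>
    commutator_mem_iff_commute_mk.mp (mem_centerMod_iff.mp ht g)
  have ha : ∀ g : G, Commute (a : G ⧸ N) (g : G ⧸ N) := by
    intro g
    obtain ⟨k, t, ht, rfl⟩ := h g
    rw [QuotientGroup.mk_mul, QuotientGroup.mk_zpow]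
    exact ((Commute.refl _).zpow_right k).mul_right (hc t ht a).symm
  obtain ⟨k, t, ht, rfl⟩ := h x
  rw [commutator_mem_iff_commute_mk, QuotientGroup.mk_mul, QuotientGroup.mk_zpow]
  exact ((ha y).zpow_left k).mul_left (hc t ht y)

variable [Finite G] {p : ℕ} [hp : Fact p.Prime]

theorem mul_card_le_card_of_lt (hG : IsPGroup p G) {H K : Subgroup G} (h : H < K) :
    p * Nat.card H ≤ Nat.card K := by
  have h1 := Subgroup.relIndex_mul_relIndex ⊥ H K bot_le h.le
  rw [Subgroup.relIndex_bot_left, Subgroup.relIndex_bot_left] at h1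
  have h2 : p ∣ H.relIndex K := by
    obtain ⟨k, hk⟩ := (hG.to_subgroup K).index (H.subgroupOf K)
    change H.relIndex K = _ at hk
    rcases Nat.eq_zero_or_pos k with rfl | hk0
    · rw [pow_zero, Subgroup.relIndex_eq_one] at hk
      exact absurd hk h.not_ge
    · rw [hk]; exact dvd_pow_self p hk0.ne'
  rw [← h1, mul_comm]
  have : 0 < H.relIndex K := Nat.pos_of_ne_zero Subgroup.FiniteIndex.index_ne_zero
  exact Nat.mul_le_mul_left _ (Nat.le_of_dvd this h2)

theorem exists_zpow_mul_of_card_le (hG : IsPGroup p G) {N K : Subgroup G} [N.Normal] (hNK : N ≤ K)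
    (hcard : Nat.card K ≤ p * Nat.card N) {t : G} (htK : t ∈ K) (htN : t ∉ N) {s : G}
    (hs : s ∈ K) : ∃ k : ℤ, ∃ n ∈ N, s = t ^ k * n := by
  have hle : Subgroup.zpowers t ⊔ N ≤ K := sup_le (by simpa using htK) hNK
  have hlt : N < Subgroup.zpowers t ⊔ N := by
    refine lt_of_le_of_ne le_sup_right fun h => htN ?_
    rw [h]
    exact (le_sup_left : _ ≤ Subgroup.zpowers t ⊔ N) (Subgroup.mem_zpowers t)
  have hK : Subgroup.zpowers t ⊔ N = K :=
    Subgroup.eq_of_le_of_card_ge hle (hcard.trans (mul_card_le_card_of_lt hG hlt))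
  rw [← hK, Subgroup.mem_sup_of_normal_right] at hs
  obtain ⟨_, ⟨k, rfl⟩, n, hn, rfl⟩ := hs
  exact ⟨k, n, hn, rfl⟩

theorem commutator_mem_of_card_centerMod (hG : IsPGroup p G) {N : Subgroup G} [N.Normal]
    (h : Nat.card G ≤ p * Nat.card (centerMod N)) (x y : G) : ⁅x, y⁆ ∈ N := by
  by_cases htop : centerMod N = ⊤
  · exact mem_centerMod_iff.mp (htop ▸ Subgroup.mem_top x) y
  · obtain ⟨a, ha⟩ : ∃ a, a ∉ centerMod N := by
      by_contra! hall
      exact htop ((Subgroup.eq_top_iff' _).mpr hall)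
    refine commutator_mem_of_centerMod_cyclic (a := a) (fun g => ?_) x y
    exact exists_zpow_mul_of_card_le hG (K := ⊤) le_top (by simpa using h) (Subgroup.mem_top a) ha
      (Subgroup.mem_top g)

theorem pow_mem_of_index_eq_prime_sq {N : Subgroup G} [N.Normal] (hN : N.index = p ^ 2)
    (hncyc : ∀ a : G, ∃ g, ∀ k : ℤ, ∀ n ∈ N, g ≠ a ^ k * n) (x : G) : x ^ p ∈ N := by
  rw [← QuotientGroup.eq_one_iff, QuotientGroup.mk_pow]
  have hc : Nat.card (G ⧸ N) = p ^ 2 := hN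
  have hd : orderOf (x : G ⧸ N) ∣ p ^ 2 := hc ▸ orderOf_dvd_natCard _
  obtain ⟨k, hk, hkx⟩ := (Nat.dvd_prime_pow hp.out).mp hd
  rcases hk.lt_or_eq with hk | rfl
  · rw [← orderOf_dvd_iff_pow_eq_one, hkx]
    exact (pow_dvd_pow p (Nat.lt_succ_iff.mp hk)).trans (by rw [pow_one])
  · exfalso
    obtain ⟨g, hg⟩ := hncyc x
    have htop : Subgroup.zpowers (x : G ⧸ N) = ⊤ :=
      Subgroup.eq_top_of_card_eq _ (by rw [Nat.card_zpowers, hkx, hc])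
    obtain ⟨k, hk⟩ : (g : G ⧸ N) ∈ Subgroup.zpowers (x : G ⧸ N) := htop ▸ Subgroup.mem_top _
    change (x : G ⧸ N) ^ k = g at hk
    rw [← QuotientGroup.mk_zpow, QuotientGroup.eq] at hk
    exact hg k _ hk (by group)

end Subgroups

/-! ### The character of `v` and its derivation -/

section Characters

variable {G : Type*} [Group G] {p : ℕ} [hp : Fact p.Prime]

theorem exists_character_of_conj {v z : G} (hz : orderOf z = p) (hzc : z ∈ Subgroup.center G)
    (hv : ∀ x, v⁻¹ * (x⁻¹ * v * x) ∈ Subgroup.zpowers z) :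
    ∃ χ : G → ZMod p, (∀ x y, χ (x * y) = χ x + χ y) ∧ ∀ x, x⁻¹ * v * x = v * modPow z (χ x) := by
  have hzp : z ^ p = 1 := hz ▸ pow_orderOf_eq_one z
  have h : ∀ x, ∃ a : ZMod p, x⁻¹ * v * x = v * modPow z a := fun x => by
    obtain ⟨a, ha⟩ := exists_modPow_of_mem_zpowers hz (hv x)
    exact ⟨a, by rw [← ha]; group⟩
  choose χ hχ using h
  refine ⟨χ, fun x y => ?_, hχ⟩
  have hcent : ∀ a : ZMod p, ∀ g, Commute (modPow z a) g := fun a g =>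
    commute_modPow (Subgroup.mem_center_iff.mp hzc g).symm a
  have h1 : (x * y)⁻¹ * v * (x * y) = y⁻¹ * (x⁻¹ * v * x) * y := by group
  have h2 : y⁻¹ * (v * modPow z (χ x)) * y = y⁻¹ * v * y * modPow z (χ x) := by
    rw [mul_assoc, mul_assoc, (hcent (χ x) y).eq]; group
  rw [hχ, hχ, h2, hχ, mul_assoc, ← modPow_add hzp] at h1
  rw [(modPow_inj hz).mp (mul_left_cancel h1), add_comm]

/-- Conjugating `v ^ χ g` by `h` produces the extra factor `z ^ (χ g * χ h)`. This is the defect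
from additivity of the binomial `χ (χ - 1) / 2`, so that exponent of `z` repairs `v ^ χ` into a
derivation. Halving needs `p` odd. The values commute with `v`, hence lie in the kernel of `χ`. -/
theorem exists_conj_of_character (hodd : Odd p)
    (hinn : ∀ φ : MulAut G, orderOf φ = p → IsInnerAut φ)
    {v z : G} (hv : v ^ p = 1) (hvc : v ∉ Subgroup.center G) (hz : orderOf z = p)
    (hzc : z ∈ Subgroup.center G) {χ : G → ZMod p} (hχ : ∀ x y, χ (x * y) = χ x + χ y)
    (hχv : ∀ x, x⁻¹ * v * x = v * modPow z (χ x)) :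
    ∃ a : G, ∀ x, a * x * a⁻¹ = x * (modPow v (χ x) * modPow z (χ x * (χ x - 1) / 2)) := by
  have hzp : z ^ p = 1 := hz ▸ pow_orderOf_eq_one z
  have hcent : ∀ a : ZMod p, ∀ g, Commute (modPow z a) g := fun a g =>
    commute_modPow (Subgroup.mem_center_iff.mp hzc g).symm a
  have h2 : (2 : ZMod p) ≠ 0 := by
    have h3 : p ≠ 2 := by rintro rfl; exact absurd hodd (by decide)
    exact (ZMod.prime_ne_zero p 2 h3)
  have hχ1 : χ 1 = 0 := by
    have := hχ 1 1
    rw [mul_one] at this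
    simpa using this
  have hχpow : ∀ g (n : ℕ), χ (g ^ n) = n * χ g := by
    intro g n
    induction n with
    | zero => simpa using hχ1
    | succ n ih => rw [pow_succ, hχ, ih]; push_cast; ring
  have hχcomm : ∀ g, Commute g v → χ g = 0 := by
    intro g hg
    have h := hχv g
    rw [mul_assoc, ← hg.eq, inv_mul_cancel_left] at h
    have h' : modPow z (χ g) = modPow z (0 : ZMod p) := by
      rw [modPow_zero]
      exact (mul_eq_left.mp h.symm)
    exact (modPow_inj hz).mp h'
  apply exists_conj_of_derivation hp.out hinn
    (fun x => modPow v (χ x) * modPow z (χ x * (χ x - 1) / 2))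
  · intro g h
    have e : h⁻¹ * (modPow v (χ g) * modPow z (χ g * (χ g - 1) / 2)) * h
        = modPow v (χ g) * modPow z (χ h * χ g) * modPow z (χ g * (χ g - 1) / 2) := by
      have : h⁻¹ * (modPow v (χ g) * modPow z (χ g * (χ g - 1) / 2)) * h =
          h⁻¹ * modPow v (χ g) * h * modPow z (χ g * (χ g - 1) / 2) := by
        rw [mul_assoc, mul_assoc, (hcent _ h).eq]; group
      rw [this, conj_modPow, hχv, modPow_mul_base (hcent _ v).symm, modPow_mul hzp]
    rw [e, hχ, modPow_add hv]
    have e2 : (χ g + χ h) * (χ g + χ h - 1) / 2 =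
        χ h * χ g + χ g * (χ g - 1) / 2 + χ h * (χ h - 1) / 2 := by
      field_simp; ring
    rw [e2, modPow_add hzp, modPow_add hzp]
    have hc := (hcent (χ h * χ g) (modPow v (χ h) : G)).eq
    have hc' := (hcent (χ g * (χ g - 1) / 2) (modPow v (χ h) : G)).eq
    simp only [mul_assoc]
    rw [← mul_assoc (modPow z (χ g * (χ g - 1) / 2)) (modPow v (χ h)), hc']
    simp only [mul_assoc]
    rw [← mul_assoc (modPow z (χ h * χ g)) (modPow v (χ h)), hc]
    simp only [mul_assoc]
  · intro g
    have h0 : χ (modPow v (χ g) * modPow z (χ g * (χ g - 1) / 2)) = 0 :=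
      hχcomm _ ((commute_modPow (Commute.refl v) _).mul_left (hcent _ v))
    simp only [h0, zero_mul, zero_div, modPow_zero, mul_one]
  · intro g
    rw [((hcent _ _).symm).mul_pow, modPow_pow hv, modPow_pow hzp, mul_one]
  · by_contra! hall
    apply hvc
    rw [Subgroup.mem_center_iff]
    intro g
    by_cases hg : χ g = 0
    · have h := hχv g
      rw [hg, modPow_zero, mul_one] at h
      have h2 := congrArg (g * ·) h
      simpa [mul_assoc] using h2.symm
    · have h1 : modPow v (χ g) ∈ Subgroup.center G := by
        have := eq_inv_of_mul_eq_one_left (hall g)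
        rw [this]
        exact inv_mem (modPow_mem hzc _)
      exact Subgroup.mem_center_iff.mp (mem_of_modPow_mem hv hg h1) g

end Characters

/-! ### Abelian groups and groups of class two -/

section SmallClass

variable {G : Type*} [Group G]

theorem commutatorElement_pow_right {x y : G} (h : Commute ⁅y, x⁆ x) (n : ℕ) :
    ⁅y, x ^ n⁆ = ⁅y, x⁆ ^ n := by
  have h1 : y * x ^ n * y⁻¹ = ⁅y, x⁆ ^ n * x ^ n := by
    rw [← h.mul_pow, ← conj_pow, commutatorElement_def]; group
  rw [commutatorElement_def, h1]; group

theorem centerMod_bot : centerMod (⊥ : Subgroup G) = Subgroup.center G := by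
  ext x
  rw [mem_centerMod_iff, Subgroup.mem_center_iff]
  simp only [Subgroup.mem_bot, commutatorElement_eq_one_iff_commute]
  exact ⟨fun h y => (h y).symm, fun h y => (h y).symm⟩

theorem exists_ne_zpow_mul_of_centerMod_ne_top {N : Subgroup G} [N.Normal] (h : centerMod N ≠ ⊤)
    (a : G) : ∃ g, ∀ k : ℤ, ∀ n ∈ centerMod N, g ≠ a ^ k * n := by
  by_contra! hcyc
  refine h ((Subgroup.eq_top_iff' _).mpr fun x => mem_centerMod_iff.mpr fun y => ?_)
  exact commutator_mem_of_centerMod_cyclic hcyc x y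

theorem mul_pow_prime_of_class_two {p : ℕ} (hp : p.Prime) (hodd : Odd p)
    (hc : ∀ x y : G, ⁅x, y⁆ ∈ Subgroup.center G) (hcp : ∀ x y : G, ⁅x, y⁆ ^ p = 1) (a b : G) :
    (a * b) ^ p = a ^ p * b ^ p := by
  have h := fun g => (Subgroup.mem_center_iff.mp (hc b⁻¹ a⁻¹) g).symm
  refine mul_pow_prime_of_commutator_central hp hodd (z := ⁅b⁻¹, a⁻¹⁆) ?_ (h a) (h b) (hcp _ _)
  rw [commutatorElement_def]; group

variable {p : ℕ} [hp : Fact p.Prime]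

theorem exists_conj_of_hom (hinn : ∀ φ : MulAut G, orderOf φ = p → IsInnerAut φ)
    {z : G} (hz : orderOf z = p) (hzc : z ∈ Subgroup.center G)
    {f : G →* Multiplicative (ZMod p)} (hfz : f z = 1) :
    ∃ a : G, ∀ x, a * x * a⁻¹ = x * modPow z (f x).toAdd := by
  by_cases hf : f = 1
  · exact ⟨1, fun x => by simp [hf, modPow_zero]⟩
  have hzp : z ^ p = 1 := hz ▸ pow_orderOf_eq_one z
  have hcent : ∀ a : ZMod p, ∀ g, Commute (modPow z a) g := fun a g =>
    commute_modPow (Subgroup.mem_center_iff.mp hzc g).symm a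
  apply exists_conj_of_derivation hp.out hinn (fun x => modPow z (f x).toAdd)
  · intro g h
    rw [map_mul, toAdd_mul, modPow_add hzp, mul_assoc h⁻¹, (hcent _ h).eq, inv_mul_cancel_left]
  · intro g
    have : f (modPow z (f g).toAdd) = 1 := by rw [modPow, map_pow, hfz, one_pow]
    rw [this, toAdd_one, modPow_zero]
  · exact fun g => modPow_pow hzp _
  · by_contra! hall
    apply hf
    ext1 g
    have h := hall g
    rw [← modPow_zero (p := p) z, modPow_inj hz] at h
    exact h

variable [Finite G]

theorem exists_orderOf_eq_prime_mem_center (hG : IsPGroup p G) [Nontrivial G] :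
    ∃ z ∈ Subgroup.center G, orderOf z = p := by
  have := hG.center_nontrivial
  obtain ⟨n, hn, hc⟩ := (hG.to_subgroup (Subgroup.center G)).nontrivial_iff_card.mp this
  obtain ⟨z, hz⟩ := exists_prime_orderOf_dvd_card' p (hc ▸ dvd_pow_self p hn.ne')
  exact ⟨z, z.2, by rw [← hz, Subgroup.orderOf_coe]⟩

theorem exists_not_isInnerAut_of_comm (hG : IsPGroup p G) (hcomm : Subgroup.center G = ⊤)
    (hcard : p < Nat.card G) : ∃ φ : MulAut G, orderOf φ = p ∧ ¬ IsInnerAut φ := by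
  by_contra! hinn
  have : Nontrivial G := Finite.one_lt_card_iff_nontrivial.mp (hp.out.one_lt.trans hcard)
  obtain ⟨z, hzc, hz⟩ := exists_orderOf_eq_prime_mem_center hG
  have hne : Subgroup.zpowers z ≠ ⊤ := fun h => by
    have := Nat.card_zpowers z
    rw [h, hz, Subgroup.card_top] at this
    exact hcard.ne this.symm
  obtain ⟨f, hf, hf1⟩ := exists_hom_ker_ge hG hne
  obtain ⟨a, ha⟩ := exists_conj_of_hom hinn hz hzc (hf (Subgroup.mem_zpowers z))
  apply hf1
  ext1 x
  have h := ha x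
  have hac : a ∈ Subgroup.center G := hcomm ▸ Subgroup.mem_top a
  rw [← Subgroup.mem_center_iff.mp hac x, mul_inv_cancel_right, left_eq_mul,
    ← modPow_zero (p := p) z, modPow_inj hz] at h
  exact h

/-- The `p`-th power map is an endomorphism with central image. A noncentral `v` of order `p` yields
a derivation with a noncentral value, impossible for an inner automorphism in class two. If there is
no such `v`, then counting makes the kernel of the power map equal to the center, and `x ↦ x * x ^
p` is the required automorphism. -/
theorem exists_not_isInnerAut_of_class_two (hodd : Odd p) (hcard : Nat.card G = p ^ 4)
    (hcomm : Subgroup.center G ≠ ⊤) (hc : ∀ x y : G, ⁅x, y⁆ ∈ Subgroup.center G) :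
    ∃ φ : MulAut G, orderOf φ = p ∧ ¬ IsInnerAut φ := by
  by_contra! hinn
  have hG : IsPGroup p G := IsPGroup.of_card hcard
  have hp1 : 1 < p := hp.out.one_lt
  have hp0 : 0 < p := hp.out.pos
  set Z := Subgroup.center G with hZ
  have hcen : ∀ {c : G}, c ∈ Z → ∀ g, Commute c g := fun h g =>
    (Subgroup.mem_center_iff.mp h g).symm
  have : Nontrivial G := by
    rw [← Finite.one_lt_card_iff_nontrivial, hcard]
    exact Nat.one_lt_pow (by norm_num) hp1
  -- The center has order `p` or `p ^ 2`.
  have hZcard : Nat.card Z = p ∨ Nat.card Z = p ^ 2 := by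
    obtain ⟨k, hk⟩ := IsPGroup.iff_card.mp (hG.to_subgroup Z)
    have hnt : Nontrivial Z := hG.center_nontrivial
    have h1 : 1 < Nat.card Z := Finite.one_lt_card_iff_nontrivial.mpr hnt
    have h2 : p * Nat.card Z < Nat.card G := by
      by_contra! hle
      apply hcomm
      rw [hZ, ← centerMod_bot] at hle
      rw [hZ, ← centerMod_bot]
      exact (Subgroup.eq_top_iff' _).mpr fun x => mem_centerMod_iff.mpr fun y =>
        commutator_mem_of_card_centerMod hG hle x y
    rw [hk, hcard, ← pow_succ', Nat.pow_lt_pow_iff_right hp1] at h2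
    have hk0 : k ≠ 0 := by rintro rfl; rw [hk] at h1; simp at h1
    have : k = 1 ∨ k = 2 := by omega
    rcases this with rfl | rfl
    · left; rw [hk, pow_one]
    · right; exact hk
  -- The two claims are linked by `⁅y, x ^ p⁆ = ⁅y, x⁆ ^ p`. A center of order `p` gives the second
  -- directly; one of order `p ^ 2` gives the first, since `G ⧸ Z` is then noncyclic of order `p ^
  -- 2`.
  have hpow_comm : (∀ x, x ^ p ∈ Z) ∧ ∀ x y : G, ⁅x, y⁆ ^ p = 1 := by
    have hcomm_pow : ∀ x y : G, ⁅y, x ^ p⁆ = ⁅y, x⁆ ^ p := fun x y =>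
      commutatorElement_pow_right (hcen (hc y x) x) p
    rcases hZcard with h | h
    · have h1 : ∀ x y : G, ⁅x, y⁆ ^ p = 1 := fun x y => by
        have := pow_card_eq_one' (x := (⟨_, hc x y⟩ : Z))
        rw [h] at this
        exact congrArg Subtype.val this
      refine ⟨fun x => Subgroup.mem_center_iff.mpr fun y => ?_, h1⟩
      have := hcomm_pow x y
      rw [h1] at this
      exact commutatorElement_eq_one_iff_commute.mp this
    · have hidx : Z.index = p ^ 2 := by
        have h1 := Z.card_mul_index
        rw [h, hcard, show 4 = 2 + 2 from rfl, pow_add] at h1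
        exact Nat.eq_of_mul_eq_mul_left (pow_pos hp0 2) h1
      have h1 : ∀ x, x ^ p ∈ Z := by
        refine pow_mem_of_index_eq_prime_sq hidx ?_
        rw [hZ, ← centerMod_bot]
        exact exists_ne_zpow_mul_of_centerMod_ne_top (by rwa [centerMod_bot])
      refine ⟨h1, fun x y => ?_⟩
      rw [← hcomm_pow, commutatorElement_eq_one_iff_commute]
      exact (hcen (h1 y) x).symm
  obtain ⟨hpow, hcp⟩ := hpow_comm
  have hmul := mul_pow_prime_of_class_two hp.out hodd hc hcp
  by_cases hex : ∃ v, v ^ p = 1 ∧ v ∉ Z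
  · obtain ⟨v, hvp, hvZ⟩ := hex
    have hw : ∀ x, v⁻¹ * (x⁻¹ * v * x) ∈ Z := fun x => by
      have : v⁻¹ * (x⁻¹ * v * x) = ⁅v⁻¹, x⁻¹⁆ := by rw [commutatorElement_def]; group
      rw [this]; exact hc _ _
    let w : G →* G := MonoidHom.mk' (fun x => v⁻¹ * (x⁻¹ * v * x)) fun x y => by
      have h1 := (hcen (hw x) (v⁻¹ * (y⁻¹ * v * y))).eq
      have h2 := (hcen (hw x) y).eq
      calc v⁻¹ * ((x * y)⁻¹ * v * (x * y))
          = v⁻¹ * y⁻¹ * v * ((v⁻¹ * (x⁻¹ * v * x)) * y) := by group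
        _ = v⁻¹ * y⁻¹ * v * (y * (v⁻¹ * (x⁻¹ * v * x))) := by rw [h2]
        _ = v⁻¹ * (y⁻¹ * v * y) * (v⁻¹ * (x⁻¹ * v * x)) := by group
        _ = _ := h1.symm
    have hwx : ∀ x, w x = v⁻¹ * (x⁻¹ * v * x) := fun _ => rfl
    have hrange : Nat.card w.range ≤ p := by
      have h1 : w.range ≤ Z := by rintro _ ⟨x, rfl⟩; exact hw x
      have h2 : Nat.card w.range ≤ Nat.card Z := Subgroup.card_le_of_le h1
      -- When the center has order `p ^ 2`, strictness (as `v` is in the kernel) pushes the kernel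
      -- to order at least `p ^ 3`.
      have h3 : Z < w.ker := by
        refine lt_of_le_of_ne (fun x hx => ?_) fun h => hvZ ?_
        · rw [MonoidHom.mem_ker, hwx, mul_assoc, ← (hcen hx v).eq, inv_mul_cancel_left,
            inv_mul_cancel]
        · rw [h, MonoidHom.mem_ker, hwx]; group
      have h4 := mul_card_le_card_of_lt hG h3
      have h5 := w.ker.card_mul_index
      rw [Subgroup.index_ker, hcard] at h5
      rcases hZcard with h | h
      · exact h ▸ h2
      · have h6 : p ^ 3 * Nat.card w.range ≤ p ^ 3 * p := by
          calc p ^ 3 * Nat.card w.range = p * Nat.card Z * Nat.card w.range := by rw [h]; ring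
            _ ≤ Nat.card w.ker * Nat.card w.range := Nat.mul_le_mul_right _ h4
            _ = p ^ 3 * p := by rw [h5]; ring
        exact Nat.le_of_mul_le_mul_left h6 (pow_pos hp0 3)
    obtain ⟨x₀, hx₀⟩ : ∃ x, w x ≠ 1 := by
      by_contra! hall
      apply hvZ
      rw [hZ, Subgroup.mem_center_iff]
      intro g
      have h := hall g
      rw [hwx, inv_mul_eq_one] at h
      conv_lhs => rw [h]
      group
    have hz : orderOf (w x₀) = p := by
      refine orderOf_eq_prime ?_ hx₀
      have : w x₀ = ⁅v⁻¹, x₀⁻¹⁆ := by rw [commutatorElement_def, hwx]; group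
      rw [this, hcp]
    have hzp : Subgroup.zpowers (w x₀) = w.range := by
      apply Subgroup.eq_of_le_of_card_ge
      · simp
      · rw [Nat.card_zpowers, hz]; exact hrange
    obtain ⟨χ, hχ, hχv⟩ := exists_character_of_conj hz (hw x₀)
      (v := v) (fun x => hzp ▸ ⟨x, rfl⟩)
    obtain ⟨a, ha⟩ := exists_conj_of_character hodd hinn hvp hvZ hz (hw x₀) hχ hχv
    have hχ0 : χ x₀ ≠ 0 := fun h0 => hx₀ <| by
      rw [hwx, hχv, h0, modPow_zero]; group
    have h1 : modPow v (χ x₀) * modPow (w x₀) (χ x₀ * (χ x₀ - 1) / 2) ∈ Z := by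
      have h2 : modPow v (χ x₀) * modPow (w x₀) (χ x₀ * (χ x₀ - 1) / 2) = ⁅x₀⁻¹, a⁆ := by
        rw [commutatorElement_def, mul_assoc, mul_assoc, ← mul_assoc a, inv_inv, ha]; group
      rw [h2]; exact hc _ _
    have h2 := (Subgroup.mul_mem_cancel_right Z (modPow_mem (hw x₀) _)).mp h1
    exact hvZ (mem_of_modPow_mem hvp hχ0 h2)
  · push Not at hex
    let π : G →* G := MonoidHom.mk' (fun x => x ^ p) hmul
    have hker : π.ker ≤ Z := fun x hx => hex x hx
    have hran : π.range ≤ Z := by rintro _ ⟨x, rfl⟩; exact hpow x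
    have h1 := π.ker.card_mul_index
    rw [Subgroup.index_ker, hcard] at h1
    have h2 : Nat.card π.range ≤ p ^ 2 := by
      refine (Subgroup.card_le_of_le hran).trans ?_
      rcases hZcard with h | h
      · rw [h]; exact Nat.le_self_pow (by norm_num) p
      · rw [h]
    have h3 : p ^ 2 ≤ Nat.card π.ker := by
      have : p ^ 2 * p ^ 2 ≤ Nat.card π.ker * p ^ 2 := by
        rw [← pow_add]; exact h1.symm.le.trans (Nat.mul_le_mul_left _ h2)
      exact Nat.le_of_mul_le_mul_right this (pow_pos hp0 2)
    have h4 : π.ker = Z := by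
      apply Subgroup.eq_of_le_of_card_ge hker
      refine le_trans ?_ h3
      rcases hZcard with h | h
      · rw [h]; exact Nat.le_self_pow (by norm_num) p
      · rw [h]
    have hpp : ∀ x : G, (x ^ p) ^ p = 1 := fun x => by
      have := hpow x
      rw [← h4] at this
      exact this
    have hne : ∃ x : G, x ^ p ≠ 1 := by
      by_contra! hall
      apply hcomm
      rw [← h4]
      exact (Subgroup.eq_top_iff' _).mpr hall
    obtain ⟨a, ha⟩ := exists_conj_of_derivation hp.out hinn (fun x => x ^ p)
      (fun g h => by
        simp only [hmul]
        rw [mul_assoc h⁻¹, (hcen (hpow g) h).eq, inv_mul_cancel_left]) hpp hpp hne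
    -- Evaluating the conjugation by `a` at `a` itself gives `a ^ p = 1`, so `a` is central and the
    -- automorphism trivial.
    have haZ : a ∈ Z := by
      apply hex
      have := ha a
      rwa [mul_inv_cancel_right, left_eq_mul] at this
    obtain ⟨x, hx⟩ := hne
    apply hx
    have := ha x
    rwa [(hcen haZ x).eq, mul_inv_cancel_right, left_eq_mul] at this

end SmallClass

/-! ### Orders of the upper central subgroups -/

section Counting

variable {G : Type*} [Group G]

theorem mem_upperCentralSeries_succ_iff_commutatorElement {n : ℕ} {x : G} :
    x ∈ Subgroup.upperCentralSeries G (n + 1) ↔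
      ∀ y, ⁅x, y⁆ ∈ Subgroup.upperCentralSeries G n :=
  Subgroup.mem_upperCentralSeries_succ_iff

theorem centerMod_upperCentralSeries (n : ℕ) :
    centerMod (Subgroup.upperCentralSeries G n) = Subgroup.upperCentralSeries G (n + 1) := by
  ext x
  rw [mem_centerMod_iff, mem_upperCentralSeries_succ_iff_commutatorElement]

variable [Finite G] {p : ℕ} [hp : Fact p.Prime]

instance : Finite (G →* Multiplicative (ZMod p)) :=
  Finite.of_injective (fun f => (f : G → Multiplicative (ZMod p))) DFunLike.coe_injective

/-- Take `f₁` nontrivial at `a`, and `f₂` nontrivial but killing `a` as well as `H`; the products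
`f₁ ^ i * f₂ ^ j` are then distinct. -/
theorem sq_le_ncard_hom_of_not_cyclic (hG : IsPGroup p G) {H : Subgroup G} [H.Normal]
    (hcyc : ∀ a : G, ∃ g, ∀ k : ℤ, ∀ n ∈ H, g ≠ a ^ k * n) :
    p ^ 2 ≤ {f : G →* Multiplicative (ZMod p) | H ≤ f.ker}.ncard := by
  have hH : H ≠ ⊤ := by
    rintro rfl
    obtain ⟨g, hg⟩ := hcyc 1
    exact hg 0 g (Subgroup.mem_top g) (by simp)
  obtain ⟨f₁, hf₁, hne₁⟩ := exists_hom_ker_ge hG hH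
  obtain ⟨a, ha⟩ : ∃ a, f₁ a ≠ 1 := by
    by_contra! hall
    exact hne₁ (MonoidHom.ext hall)
  have hHa : Subgroup.zpowers a ⊔ H ≠ ⊤ := by
    intro htop
    obtain ⟨g, hg⟩ := hcyc a
    have : g ∈ Subgroup.zpowers a ⊔ H := htop ▸ Subgroup.mem_top g
    rw [Subgroup.mem_sup_of_normal_right] at this
    obtain ⟨_, ⟨k, rfl⟩, n, hn, rfl⟩ := this
    exact hg k n hn rfl
  obtain ⟨f₂, hf₂, hne₂⟩ := exists_hom_ker_ge hG hHa
  have hf₂a : f₂ a = 1 :=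
    hf₂ ((le_sup_left : _ ≤ Subgroup.zpowers a ⊔ H) (Subgroup.mem_zpowers a))
  obtain ⟨b, hb⟩ : ∃ b, f₂ b ≠ 1 := by
    by_contra! hall
    exact hne₂ (MonoidHom.ext hall)
  have hord : ∀ t : Multiplicative (ZMod p), t ≠ 1 → orderOf t = p := fun t ht =>
    orderOf_eq_prime (by simpa using pow_card_eq_one' (x := t)) ht
  let F : ZMod p × ZMod p → {f : G →* Multiplicative (ZMod p) | H ≤ f.ker} := fun ij =>
    ⟨f₁ ^ ij.1.val * f₂ ^ ij.2.val, fun x hx => by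
      have h1 : f₁ x = 1 := hf₁ hx
      have h2 : f₂ x = 1 := hf₂ ((le_sup_right : H ≤ Subgroup.zpowers a ⊔ H) hx)
      simp [MonoidHom.mem_ker, h1, h2]⟩
  have hF : Function.Injective F := by
    rintro ⟨i, j⟩ ⟨i', j'⟩ h
    have h' : ∀ x, f₁ x ^ i.val * f₂ x ^ j.val = f₁ x ^ i'.val * f₂ x ^ j'.val := fun x =>
      DFunLike.congr_fun (congrArg Subtype.val h) x
    have hi : i = i' := by
      have := h' a
      rw [hf₂a, one_pow, one_pow, mul_one, mul_one] at this
      exact (modPow_inj (hord _ ha)).mp this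
    subst hi
    have hj : j = j' := (modPow_inj (hord _ hb)).mp (mul_left_cancel (h' b))
    rw [hj]
  have := Nat.card_le_card_of_injective F hF
  rwa [Nat.card_prod, Nat.card_zmod, ← sq, Nat.card_coe_set_eq] at this

/-- Each such `f` is realised by conjugation by an element of the second center, and `f` is
recovered from its coset modulo the center. -/
theorem ncard_hom_mul_card_center_le (hinn : ∀ φ : MulAut G, orderOf φ = p → IsInnerAut φ)
    {z : G} (hz : orderOf z = p) (hzc : z ∈ Subgroup.center G) :
    {f : G →* Multiplicative (ZMod p) | f z = 1}.ncard * Nat.card (Subgroup.center G) ≤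
      Nat.card (Subgroup.upperCentralSeries G 2) := by
  have h : ∀ f : {f : G →* Multiplicative (ZMod p) | f z = 1},
      ∃ a : G, ∀ x, a * x * a⁻¹ = x * modPow z (f.1 x).toAdd := fun f =>
    exists_conj_of_hom hinn hz hzc f.2
  choose a ha using h
  have ha2 : ∀ f, a f ∈ Subgroup.upperCentralSeries G 2 := fun f => by
    rw [mem_upperCentralSeries_succ_iff_commutatorElement]
    intro x
    rw [Subgroup.upperCentralSeries_one, commutatorElement_def, ha,
      Subgroup.mem_center_iff.mp (modPow_mem hzc _) x, mul_inv_cancel_right]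
    exact modPow_mem hzc _
  have hle : Subgroup.center G ≤ Subgroup.upperCentralSeries G 2 := by
    rw [← Subgroup.upperCentralSeries_one]
    exact Subgroup.upperCentralSeries_mono G one_le_two
  let F : {f : G →* Multiplicative (ZMod p) | f z = 1} × Subgroup.center G →
      Subgroup.upperCentralSeries G 2 := fun fc => ⟨a fc.1 * fc.2, mul_mem (ha2 _) (hle fc.2.2)⟩
  have hF : Function.Injective F := by
    rintro ⟨f, c⟩ ⟨f', c'⟩ h
    have h1 : a f * c = a f' * c' := congrArg Subtype.val h
    have hconj : ∀ f (c : Subgroup.center G) x,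
        a f * c * x * (a f * c)⁻¹ = x * modPow z (f.1 x).toAdd := fun f c x => by
      rw [← ha, mul_assoc (a f), ← Subgroup.mem_center_iff.mp c.2 x]; group
    have hff : f = f' := by
      apply Subtype.ext
      ext1 x
      have h2 := hconj f c x
      rw [h1, hconj, mul_right_inj, modPow_inj hz] at h2
      exact h2.symm
    subst hff
    rw [Subtype.ext (mul_left_cancel h1)]
  have := Nat.card_le_card_of_injective F hF
  rwa [Nat.card_prod, Nat.card_coe_set_eq] at this

/-- If every automorphism of order `p` is inner, the upper central factors of a `p`-group of
coclass `2` and class `m + 3` have orders `p, p ^ 2, p, …, p, p ^ 2`. -/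
theorem card_upperCentralSeries_of_coclass_two {m : ℕ} (hcard : Nat.card G = p ^ (m + 5))
    (hclass : Group.nilpotencyClass G = m + 3)
    (hinn : ∀ φ : MulAut G, orderOf φ = p → IsInnerAut φ) :
    Nat.card (Subgroup.center G) = p ∧
      (∀ i, 2 ≤ i → i ≤ m + 2 → Nat.card (Subgroup.upperCentralSeries G i) = p ^ (i + 1)) ∧
      ∀ z ∈ Subgroup.center G, orderOf z = p → ∀ f : G →* Multiplicative (ZMod p), f z = 1 →
        Subgroup.upperCentralSeries G (m + 2) ≤ f.ker := by
  have hG : IsPGroup p G := IsPGroup.of_card hcard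
  have hnil : Group.IsNilpotent G := hG.isNilpotent
  have hp1 : 1 < p := hp.out.one_lt
  have : Nontrivial G := by
    rw [← Finite.one_lt_card_iff_nontrivial, hcard]
    exact Nat.one_lt_pow (by omega) hp1
  obtain ⟨z, hzc, hz⟩ := exists_orderOf_eq_prime_mem_center hG
  have htop : ∀ n, Subgroup.upperCentralSeries G n = ⊤ ↔ m + 3 ≤ n := fun n => by
    rw [← hclass]; exact Subgroup.upperCentralSeries_eq_top_iff_nilpotencyClass_le
  have hnc : ∀ n ≤ m + 2, centerMod (Subgroup.upperCentralSeries G (n - 1)) ≠ ⊤ := fun n hn h => by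
    rw [centerMod_upperCentralSeries, htop] at h
    omega
  have hcyc := exists_ne_zpow_mul_of_centerMod_ne_top (hnc (m + 2) le_rfl)
  rw [show m + 2 - 1 = m + 1 from rfl, centerMod_upperCentralSeries] at hcyc
  have hDH := sq_le_ncard_hom_of_not_cyclic hG hcyc
  have hsub : ∀ z ∈ Subgroup.center G,
      {f : G →* Multiplicative (ZMod p) | Subgroup.upperCentralSeries G (m + 1 + 1) ≤ f.ker} ⊆
        {f | f z = 1} := fun z hzc f hf => by
    refine hf (Subgroup.upperCentralSeries_mono G (by omega : 1 ≤ m + 1 + 1) ?_)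
    rwa [Subgroup.upperCentralSeries_one]
  have hD := ncard_hom_mul_card_center_le hinn hz hzc
  choose k hk using fun i => IsPGroup.iff_card.mp (hG.to_subgroup (Subgroup.upperCentralSeries G i))
  have hkc : Nat.card (Subgroup.center G) = p ^ k 1 := by
    rw [← hk, Subgroup.upperCentralSeries_one]
  have hmono : ∀ i ≤ m + 2, k i < k (i + 1) := fun i hi => by
    have hlt : Subgroup.upperCentralSeries G i < Subgroup.upperCentralSeries G (i + 1) :=
      Subgroup.upperCentralSeries.StrictMonoOn (G := G) (by simp [hclass]; omega)
        (by simp [hclass]; omega) (Nat.lt_succ_self i)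
    have := mul_card_le_card_of_lt hG hlt
    rw [hk, hk, ← pow_succ', Nat.pow_le_pow_iff_right hp1] at this
    exact this
  have hk2 : k 1 + 2 ≤ k 2 := by
    have h1 : p ^ 2 * p ^ k 1 ≤ p ^ k 2 := by
      rw [← hk 2, ← hkc]
      refine (Nat.mul_le_mul_right _ ?_).trans hD
      exact hDH.trans (Set.ncard_le_ncard (hsub z hzc) (Set.toFinite _))
    rw [← pow_add, Nat.pow_le_pow_iff_right hp1] at h1
    omega
  -- Otherwise the quotient by the `(m + 2)`-th center has order at most `p`, making the quotient by
  -- the previous one abelian.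
  have hktop : k (m + 2) ≤ m + 3 := by
    by_contra! hlt
    apply hnc (m + 2) le_rfl
    rw [show m + 2 - 1 = m + 1 from rfl]
    refine (Subgroup.eq_top_iff' _).mpr fun x => mem_centerMod_iff.mpr fun y =>
      commutator_mem_of_card_centerMod hG ?_ x y
    rw [centerMod_upperCentralSeries, hk, hcard, ← pow_succ', Nat.pow_le_pow_iff_right hp1]
    change m + 5 ≤ k (m + 2) + 1
    omega
  -- Strict growth climbs from `k 2` here and descends from `k (m + 2)` in `hupp`; the two bounds
  -- meet only if `k 1 = 1`.
  have hlow : ∀ j ≤ m, k 1 + 2 + j ≤ k (2 + j) := by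
    intro j
    induction j with
    | zero => intro _; simpa using hk2
    | succ j ih =>
      intro hj
      have h1 := ih (by omega)
      have h2 := hmono (2 + j) (by omega)
      rw [← add_assoc 2 j 1]
      omega
  have hupp : ∀ j ≤ m, k (m + 2 - j) ≤ m + 3 - j := by
    intro j
    induction j with
    | zero => intro _; simpa using hktop
    | succ j ih =>
      intro hj
      have h1 := ih (by omega)
      have h2 := hmono (m + 2 - (j + 1)) (by omega)
      rw [show m + 2 - (j + 1) + 1 = m + 2 - j by omega] at h2
      omega
  have hk1 : 1 ≤ k 1 := by have := hmono 0 (by omega); rw [zero_add] at this; omega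
  have hk1' : k 1 = 1 := by
    have h1 := hupp m le_rfl
    rw [show m + 2 - m = 2 by omega] at h1
    omega
  have hcards : ∀ i, 2 ≤ i → i ≤ m + 2 →
      Nat.card (Subgroup.upperCentralSeries G i) = p ^ (i + 1) := fun i h2 hi => by
    have h3 := hlow (i - 2) (by omega)
    have h4 := hupp (m + 2 - i) (by omega)
    rw [show 2 + (i - 2) = i by omega] at h3
    rw [show m + 2 - (m + 2 - i) = i by omega] at h4
    rw [hk, show k i = i + 1 by omega]
  have hcp : Nat.card (Subgroup.center G) = p := by rw [hkc, hk1', pow_one]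
  refine ⟨hcp, hcards, fun z hzc hz f hf => ?_⟩
  have hD := ncard_hom_mul_card_center_le hinn hz hzc
  rw [hcards 2 le_rfl (by omega), hcp, pow_succ p 2] at hD
  have hle := (Nat.le_of_mul_le_mul_right hD hp.out.pos).trans hDH
  have heq := Set.eq_of_subset_of_ncard_le (hsub z hzc) hle (Set.toFinite _)
  have hmem : f ∈ {f : G →* Multiplicative (ZMod p) | f z = 1} := hf
  rw [← heq] at hmem
  exact hmem

/-- On the second center the `p`-th power map is a homomorphism into the center, so its kernel has
order at least `p ^ 2`. -/
theorem exists_mem_upperCentralSeries_two_pow_eq_one (hodd : Odd p)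
    (h1 : Nat.card (Subgroup.center G) = p)
    (h2 : Nat.card (Subgroup.upperCentralSeries G 2) = p ^ 3) :
    ∃ v ∈ Subgroup.upperCentralSeries G 2, v ^ p = 1 ∧ v ∉ Subgroup.center G := by
  have hp0 : 0 < p := hp.out.pos
  have hcen : ∀ {c : G}, c ∈ Subgroup.center G → ∀ g, Commute c g := fun h g =>
    (Subgroup.mem_center_iff.mp h g).symm
  have hzp : ∀ c ∈ Subgroup.center G, c ^ p = 1 := fun c hc => by
    have := pow_card_eq_one' (x := (⟨c, hc⟩ : Subgroup.center G))
    rw [h1] at this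
    exact congrArg Subtype.val this
  have hcm : ∀ x ∈ Subgroup.upperCentralSeries G 2, ∀ y, ⁅x, y⁆ ∈ Subgroup.center G ∧
      ⁅y, x⁆ ∈ Subgroup.center G := fun x hx y => by
    have h := mem_upperCentralSeries_succ_iff_commutatorElement.mp hx y
    rw [Subgroup.upperCentralSeries_one] at h
    exact ⟨h, by rw [← commutatorElement_inv]; exact inv_mem h⟩
  let π : Subgroup.upperCentralSeries G 2 →* G :=
    MonoidHom.mk' (fun x => (x : G) ^ p) fun x y => by
      have h := hcm _ (inv_mem y.2) (x : G)⁻¹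
      rw [Subgroup.coe_mul]
      refine mul_pow_prime_of_commutator_central hp.out hodd (z := ⁅(y : G)⁻¹, (x : G)⁻¹⁆) ?_
        (hcen h.1 _) (hcen h.1 _) (hzp _ h.1)
      rw [commutatorElement_def]; group
  have hran : π.range ≤ Subgroup.center G := by
    rintro _ ⟨x, rfl⟩
    rw [Subgroup.mem_center_iff]
    intro y
    have h := (hcm x x.2 y).2
    have h3 := commutatorElement_pow_right (hcen h (x : G)) p
    rw [hzp _ h] at h3
    exact commutatorElement_eq_one_iff_commute.mp h3
  by_contra! hall
  have hker : π.ker.map (Subgroup.subtype _) ≤ Subgroup.center G := by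
    rintro _ ⟨x, hx, rfl⟩
    exact hall x x.2 hx
  have h3 := Subgroup.card_le_of_le hran
  have h4 := Subgroup.card_le_of_le hker
  rw [Subgroup.card_map_of_injective (Subgroup.subtype_injective _), h1] at h4
  have h5 := π.ker.card_mul_index
  rw [Subgroup.index_ker, h2] at h5
  rw [h1] at h3
  have h6 := Nat.mul_le_mul h4 h3
  rw [h5, ← sq, Nat.pow_le_pow_iff_right hp.out.one_lt] at h6
  omega

end Counting

/-! ### The conjugating element `a`, and class three -/

section ClassThree

variable {G : Type*} [Group G] {p : ℕ} [hp : Fact p.Prime]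

theorem character_eq_zero_iff {v z : G} (hz : orderOf z = p) {χ : G → ZMod p}
    (hχv : ∀ x, x⁻¹ * v * x = v * modPow z (χ x)) {x : G} : χ x = 0 ↔ Commute v x := by
  have h : χ x = 0 ↔ x⁻¹ * v * x = v := by
    rw [hχv, mul_eq_left, ← modPow_zero (p := p) z, modPow_inj hz]
  rw [h, mul_assoc, inv_mul_eq_iff_eq_mul]
  exact Iff.rfl

theorem exists_character_ne_zero {v z : G} (hz : orderOf z = p) {χ : G → ZMod p}
    (hχv : ∀ x, x⁻¹ * v * x = v * modPow z (χ x)) (hv : v ∉ Subgroup.center G) :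
    ∃ x, χ x ≠ 0 := by
  by_contra! hall
  exact hv <| Subgroup.mem_center_iff.mpr fun x =>
    ((character_eq_zero_iff hz hχv).mp (hall x)).symm.eq

/-- Membership would make every `v ^ α x * z ^ β x` central, hence `v` itself. -/
theorem notMem_upperCentralSeries_two {v z : G} {α β : G → ZMod p} (hv : v ^ p = 1)
    (hvc : v ∉ Subgroup.center G) (hzc : z ∈ Subgroup.center G) {a : G}
    (ha : ∀ x, a * x * a⁻¹ = x * (modPow v (α x) * modPow z (β x))) (hα : ∃ x, α x ≠ 0) :
    a ∉ Subgroup.upperCentralSeries G 2 := by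
  intro ha2
  obtain ⟨x, hx⟩ := hα
  have h := mem_upperCentralSeries_succ_iff_commutatorElement.mp ha2 x
  rw [Subgroup.upperCentralSeries_one, commutatorElement_def, ha] at h
  have h2 := Subgroup.Normal.conj_mem inferInstance _ h x⁻¹
  rw [show x⁻¹ * (x * (modPow v (α x) * modPow z (β x)) * x⁻¹) * x⁻¹⁻¹ =
    modPow v (α x) * modPow z (β x) by group] at h2
  have h3 := (Subgroup.mul_mem_cancel_right _ (modPow_mem hzc (β x))).mp h2
  exact hvc (mem_of_modPow_mem hv hx h3)

variable [Finite G]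

theorem exists_character_data_of_coclass_two (hodd : Odd p) {m : ℕ}
    (hcard : Nat.card G = p ^ (m + 5)) (hclass : Group.nilpotencyClass G = m + 3)
    (hinn : ∀ φ : MulAut G, orderOf φ = p → IsInnerAut φ) :
    ∃ (z v a : G) (χ : G → ZMod p), orderOf z = p ∧ z ∈ Subgroup.center G ∧ v ^ p = 1 ∧
      v ∈ Subgroup.upperCentralSeries G 2 ∧ v ∉ Subgroup.center G ∧
      (∀ x y, χ (x * y) = χ x + χ y) ∧ (∀ x, x⁻¹ * v * x = v * modPow z (χ x)) ∧
      (∀ x, a * x * a⁻¹ = x * (modPow v (χ x) * modPow z (χ x * (χ x - 1) / 2))) ∧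
      ∀ x ∈ Subgroup.upperCentralSeries G (m + 2), χ x = 0 := by
  obtain ⟨h1, h2, hD⟩ := card_upperCentralSeries_of_coclass_two hcard hclass hinn
  have hG : IsPGroup p G := IsPGroup.of_card hcard
  have : Nontrivial G := by
    rw [← Finite.one_lt_card_iff_nontrivial, hcard]
    exact Nat.one_lt_pow (by omega) hp.out.one_lt
  obtain ⟨v, hv2, hvp, hvc⟩ :=
    exists_mem_upperCentralSeries_two_pow_eq_one hodd h1 (h2 2 le_rfl (by omega))
  obtain ⟨z, hzc, hz⟩ := exists_orderOf_eq_prime_mem_center hG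
  have hzZ : Subgroup.zpowers z = Subgroup.center G := by
    apply Subgroup.eq_of_le_of_card_ge
    · simpa using hzc
    · rw [Nat.card_zpowers, hz, h1]
  obtain ⟨χ, hχ, hχv⟩ := exists_character_of_conj (v := v) hz hzc fun x => by
    have h := mem_upperCentralSeries_succ_iff_commutatorElement.mp (inv_mem hv2) x⁻¹
    rw [Subgroup.upperCentralSeries_one, commutatorElement_def] at h
    rw [hzZ]
    simpa [mul_assoc] using h
  obtain ⟨a, ha⟩ := exists_conj_of_character hodd hinn hvp hvc hz hzc hχ hχv
  refine ⟨z, v, a, χ, hz, hzc, hvp, hv2, hvc, hχ, hχv, ha, fun x hx => ?_⟩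
  let f : G →* Multiplicative (ZMod p) := MonoidHom.mk' (fun x => Multiplicative.ofAdd (χ x))
    fun x y => by rw [hχ, ofAdd_add]
  have hfz : f z = 1 := (character_eq_zero_iff hz hχv).mpr (Subgroup.mem_center_iff.mp hzc v)
  exact hD z hzc hz f hfz hx

theorem exists_not_isInnerAut_of_class_three (hodd : Odd p)
    (hcard : Nat.card G = p ^ 5) (hclass : Group.nilpotencyClass G = 3) :
    ∃ φ : MulAut G, orderOf φ = p ∧ ¬ IsInnerAut φ := by
  by_contra! hinn
  obtain ⟨h1, h2, hD⟩ := card_upperCentralSeries_of_coclass_two (m := 0) hcard hclass hinn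
  obtain ⟨z, v, a, χ, hz, hzc, hvp, hv2, hvc, hχ, hχv, ha, -⟩ :=
    exists_character_data_of_coclass_two (m := 0) hodd hcard hclass hinn
  have hG : IsPGroup p G := IsPGroup.of_card hcard
  have hZ2 : Nat.card (Subgroup.upperCentralSeries G 2) = p ^ 3 := h2 2 le_rfl le_rfl
  have hcen : ∀ {c : G}, c ∈ Subgroup.center G → ∀ g, Commute c g := fun h g =>
    (Subgroup.mem_center_iff.mp h g).symm
  have hcp : ∀ c ∈ Subgroup.center G, c ^ p = 1 := fun c hc => by
    have := pow_card_eq_one' (x := (⟨c, hc⟩ : Subgroup.center G))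
    rw [h1] at this
    exact congrArg Subtype.val this
  have hcm : ∀ x ∈ Subgroup.upperCentralSeries G 2, ∀ y, ⁅x, y⁆ ∈ Subgroup.center G :=
    fun x hx y => by
      have h := mem_upperCentralSeries_succ_iff_commutatorElement.mp hx y
      rwa [Subgroup.upperCentralSeries_one] at h
  have hord : orderOf v = p := orderOf_eq_prime hvp fun h => hvc (h ▸ one_mem _)
  let V : Subgroup G := Subgroup.zpowers v ⊔ Subgroup.center G
  have hvV : v ∈ V := (le_sup_left : Subgroup.zpowers v ≤ V) (Subgroup.mem_zpowers v)
  have hZV : Subgroup.center G ≤ V := le_sup_right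
  have hVmem : ∀ n ∈ V, ∃ i : ZMod p, ∃ c ∈ Subgroup.center G, n = modPow v i * c :=
    fun n hn => by
      obtain ⟨y, hy, c, hc, rfl⟩ := Subgroup.mem_sup_of_normal_right.mp hn
      obtain ⟨i, rfl⟩ := exists_modPow_of_mem_zpowers hord hy
      exact ⟨i, c, hc, rfl⟩
  have hV2 : V ≤ Subgroup.upperCentralSeries G 2 := by
    refine sup_le (by simpa using hv2) ?_
    rw [← Subgroup.upperCentralSeries_one]
    exact Subgroup.upperCentralSeries_mono G one_le_two
  have hVn : V.Normal := ⟨fun n hn g => by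
    have h : ⁅g, n⁆ ∈ Subgroup.center G := by
      rw [← commutatorElement_inv]; exact inv_mem (hcm n (hV2 hn) g)
    rw [show g * n * g⁻¹ = ⁅g, n⁆ * n by rw [commutatorElement_def]; group]
    exact mul_mem (hZV h) hn⟩
  have haV : a ∈ centerMod V := mem_centerMod_iff.mpr fun y => by
    rw [commutatorElement_def, ha]
    exact hVn.conj_mem _ (mul_mem (modPow_mem hvV _) (modPow_mem (hZV hzc) _)) y
  have hlt : Subgroup.upperCentralSeries G 2 < centerMod V := by
    refine lt_of_le_of_ne (fun x hx => mem_centerMod_iff.mpr fun y => hZV (hcm x hx y)) ?_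
    intro h
    exact notMem_upperCentralSeries_two hvp hvc hzc ha (exists_character_ne_zero hz hχv hvc)
      (h ▸ haV)
  -- As `a` lies outside the second center, `centerMod V` has order at least `p ^ 4`, so index at
  -- most `p`.
  have hcomm : ∀ x y : G, ⁅x, y⁆ ∈ V := by
    refine commutator_mem_of_card_centerMod hG ?_
    have := mul_card_le_card_of_lt hG hlt
    rw [hZ2, ← pow_succ'] at this
    rw [hcard, pow_succ']
    exact Nat.mul_le_mul_left p this
  have hVp : ∀ n ∈ V, n ^ p = 1 := fun n hn => by
    obtain ⟨i, c, hc, rfl⟩ := hVmem n hn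
    rw [(hcen hc _).symm.mul_pow, modPow_pow hvp, hcp c hc, mul_one]
  -- A conjugate of `x` is `w * x` with `w` in `V`; since `w ^ p = 1` and `w`, `x` have a central
  -- commutator of exponent `p`, its `p`-th power is still `x ^ p`.
  have hpow : ∀ x : G, x ^ p ∈ Subgroup.center G := fun x => by
    rw [Subgroup.mem_center_iff]
    intro y
    have hw := hcomm y x
    have hc := hcm _ (inv_mem (hV2 hw)) x⁻¹
    rw [← inv_mem_iff, commutatorElement_inv] at hc
    have h3 : (⁅y, x⁆ * x) ^ p = ⁅y, x⁆ ^ p * x ^ p :=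
      mul_pow_prime_of_commutator_central hp.out hodd (z := ⁅x⁻¹, ⁅y, x⁆⁻¹⁆)
        (by simp only [commutatorElement_def]; group) (hcen hc _) (hcen hc _) (hcp _ hc)
    rw [hVp _ hw, one_mul, show ⁅y, x⁆ * x = y * x * y⁻¹ by rw [commutatorElement_def]; group,
      conj_pow, mul_inv_eq_iff_eq_mul] at h3
    exact h3
  obtain ⟨u, hu2, huV⟩ : ∃ u ∈ Subgroup.upperCentralSeries G 2, u ∉ V := by
    by_contra! hall
    let F : ZMod p × Subgroup.center G → V := fun ic =>
      ⟨modPow v ic.1 * ic.2, mul_mem (modPow_mem hvV _) (hZV ic.2.2)⟩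
    have hF : Function.Surjective F := by
      rintro ⟨n, hn⟩
      obtain ⟨i, c, hc, rfl⟩ := hVmem n hn
      exact ⟨(i, ⟨c, hc⟩), rfl⟩
    have h3 := Nat.card_le_card_of_surjective F hF
    rw [Nat.card_prod, Nat.card_zmod, h1, ← sq] at h3
    have h4 := (Subgroup.card_le_of_le hall).trans h3
    rw [hZ2, Nat.pow_le_pow_iff_right hp.out.one_lt] at h4
    omega
  have hQcomm : ∀ x y : G ⧸ V, x * y = y * x := fun x y => by
    obtain ⟨x, rfl⟩ := QuotientGroup.mk_surjective x
    obtain ⟨y, rfl⟩ := QuotientGroup.mk_surjective y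
    exact commutator_mem_iff_commute_mk.mp (hcomm x y)
  have hQpow : ∀ x : G ⧸ V, x ^ p = 1 := fun x => by
    obtain ⟨x, rfl⟩ := QuotientGroup.mk_surjective x
    exact (QuotientGroup.eq_one_iff _).mpr (hZV (hpow x))
  obtain ⟨f, hf⟩ := exists_hom_apply_ne_one hQcomm hQpow (u := (u : G ⧸ V))
    (fun h => huV ((QuotientGroup.eq_one_iff u).mp h))
  have hfz : f.comp (QuotientGroup.mk' V) z = 1 := by
    have : QuotientGroup.mk' V z = 1 := (QuotientGroup.eq_one_iff z).mpr (hZV hzc)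
    rw [MonoidHom.comp_apply, this, map_one]
  exact hf (hD z hzc hz (f.comp (QuotientGroup.mk' V)) hfz hu2)

end ClassThree

/-! ### Extending derivations, and `p`-th powers in large class -/

section LargeClass

variable {G : Type*} [Group G] {p : ℕ} [hp : Fact p.Prime]

/-- A crossed homomorphism on the kernel of `χ` that commutes with conjugation by `b` and is
trivial at `b ^ p` extends to the whole group by being trivial at `b`. -/
theorem exists_derivation_extension {χ : G → ZMod p} (hχ : ∀ x y, χ (x * y) = χ x + χ y)
    {b : G} (hb : χ b = 1) {η : G → G}
    (hη : ∀ m n, χ m = 0 → χ n = 0 → η (m * n) = η m * η n)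
    (hcomm : ∀ m n, χ m = 0 → χ n = 0 → Commute (η m) n)
    (hconj : ∀ m, χ m = 0 → η (b⁻¹ * m * b) = b⁻¹ * η m * b) (hbp : η (b ^ p) = 1) :
    ∃ δ : G → G, (∀ m, χ m = 0 → δ m = η m) ∧
      (∀ g, ∃ m, χ m = 0 ∧ δ g = η m) ∧ ∀ g h, δ (g * h) = h⁻¹ * δ g * h * δ h := by
  have hχ1 : χ 1 = 0 := by simpa using hχ 1 1
  have hχinv : ∀ g, χ g⁻¹ = -χ g := fun g => by
    have h := hχ g⁻¹ g
    rw [inv_mul_cancel, hχ1] at h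
    exact eq_neg_of_add_eq_zero_left h.symm
  have hχpow : ∀ n : ℕ, χ (b ^ n) = n := by
    intro n
    induction n with
    | zero => simpa using hχ1
    | succ n ih => rw [pow_succ, hχ, ih, hb]; push_cast; rfl
  have hη1 : η 1 = 1 := by simpa using hη 1 1 hχ1 hχ1
  have hred : ∀ g, χ ((b ^ (χ g).val)⁻¹ * g) = 0 := fun g => by
    rw [hχ, hχinv, hχpow, ZMod.natCast_zmod_val, neg_add_cancel]
  have hbpow : ∀ q : ℕ, η (b ^ (p * q)) = 1 := by
    intro q
    induction q with
    | zero => simpa using hη1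
    | succ q ih =>
      rw [mul_add, mul_one, pow_add, hη _ _ (by simp [hχpow]) (by simp [hχpow]), ih, hbp, one_mul]
  have hconjpow : ∀ (j : ℕ) m, χ m = 0 → χ ((b ^ j)⁻¹ * m * b ^ j) = 0 ∧
      η ((b ^ j)⁻¹ * m * b ^ j) = (b ^ j)⁻¹ * η m * b ^ j := by
    intro j m hm
    refine ⟨by rw [hχ, hχ, hχinv, hm]; ring, ?_⟩
    induction j with
    | zero => simp
    | succ j ih =>
      have h0 : χ ((b ^ j)⁻¹ * m * b ^ j) = 0 := by rw [hχ, hχ, hχinv, hm]; ring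
      have e : (b ^ (j + 1))⁻¹ * m * b ^ (j + 1) = b⁻¹ * ((b ^ j)⁻¹ * m * b ^ j) * b := by
        rw [pow_succ]; group
      rw [e, hconj _ h0, ih, pow_succ]; group
  refine ⟨fun g => η ((b ^ (χ g).val)⁻¹ * g), fun m hm => ?_, fun g => ⟨_, hred g, rfl⟩,
    fun g h => ?_⟩
  · simp [hm]
  · set i := (χ g).val with hi
    set j := (χ h).val with hj
    set m := (b ^ i)⁻¹ * g with hm
    set n := (b ^ j)⁻¹ * h with hn
    have hm0 : χ m = 0 := hred g
    have hn0 : χ n = 0 := hred h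
    obtain ⟨hc0, hc⟩ := hconjpow j m hm0
    have hval : (χ (g * h)).val = (i + j) % p := by rw [hχ, ZMod.val_add]
    -- Representatives of `ZMod p` add with a carry, which contributes a power of `b ^ p`; `η` is
    -- trivial there.
    have hsplit : b ^ (i + j) = b ^ ((i + j) % p) * b ^ (p * ((i + j) / p)) := by
      rw [← pow_add, Nat.mod_add_div]
    have hgh : (b ^ (χ (g * h)).val)⁻¹ * (g * h) =
        b ^ (p * ((i + j) / p)) * (((b ^ j)⁻¹ * m * b ^ j) * n) := by
      have h1 : b ^ (p * ((i + j) / p)) = (b ^ ((i + j) % p))⁻¹ * b ^ (i + j) := by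
        rw [hsplit]; group
      rw [hval, h1, hm, hn, pow_add]; group
    have hn' : h = b ^ j * n := by rw [hn]; group
    have hcn := (hcomm _ n hc0 hn0).eq
    change η _ = h⁻¹ * η m * h * η n
    rw [hgh, hη _ _ (by simp [hχpow]) (by rw [hχ, hc0, hn0, add_zero]), hbpow, one_mul,
      hη _ _ hc0 hn0]
    congr 1
    rw [hc] at hcn ⊢
    calc (b ^ j)⁻¹ * η m * b ^ j = n⁻¹ * (n * ((b ^ j)⁻¹ * η m * b ^ j)) := by group
      _ = n⁻¹ * ((b ^ j)⁻¹ * η m * b ^ j * n) := by rw [hcn]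
      _ = h⁻¹ * η m * h := by rw [hn']; group

theorem exists_character_eq_one {χ : G → ZMod p} (hχ : ∀ x y, χ (x * y) = χ x + χ y)
    (hne : ∃ x, χ x ≠ 0) : ∃ b, χ b = 1 := by
  obtain ⟨x, hx⟩ := hne
  have hχpow : ∀ n : ℕ, χ (x ^ n) = n * χ x := by
    intro n
    induction n with
    | zero => simpa using hχ 1 1
    | succ n ih => rw [pow_succ, hχ, ih]; push_cast; ring
  exact ⟨x ^ ((χ x)⁻¹).val, by rw [hχpow, ZMod.natCast_zmod_val, inv_mul_cancel₀ hx]⟩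

theorem exists_partial_hom_apply_ne_zero {M N : Subgroup G} [N.Normal] (hNM : N ≤ M)
    (hcomm : ∀ x ∈ M, ∀ y ∈ M, ⁅x, y⁆ ∈ N) (hpow : ∀ x ∈ M, x ^ p ∈ N) {s : G} (hs : s ∈ M)
    (hsN : s ∉ N) :
    ∃ θ : G → ZMod p, (∀ x ∈ M, ∀ y ∈ M, θ (x * y) = θ x + θ y) ∧ (∀ x ∈ N, θ x = 0) ∧ θ s ≠ 0 := by
  classical
  let N' : Subgroup M := N.subgroupOf M
  have hQcomm : ∀ x y : M ⧸ N', x * y = y * x := fun x y => by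
    obtain ⟨x, rfl⟩ := QuotientGroup.mk_surjective x
    obtain ⟨y, rfl⟩ := QuotientGroup.mk_surjective y
    exact commutator_mem_iff_commute_mk.mp (hcomm x x.2 y y.2 : ⁅x, y⁆ ∈ N')
  have hQpow : ∀ x : M ⧸ N', x ^ p = 1 := fun x => by
    obtain ⟨x, rfl⟩ := QuotientGroup.mk_surjective x
    exact (QuotientGroup.eq_one_iff _).mpr (hpow x x.2)
  obtain ⟨f, hf⟩ := exists_hom_apply_ne_one hQcomm hQpow (u := ((⟨s, hs⟩ : M) : M ⧸ N'))
    (fun h => hsN ((QuotientGroup.eq_one_iff _).mp h : (⟨s, hs⟩ : M) ∈ N'))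
  refine ⟨fun x => if h : x ∈ M then (f ((⟨x, h⟩ : M) : M ⧸ N')).toAdd else 0,
    fun x hx y hy => ?_, fun x hx => ?_, ?_⟩
  · simp only [hx, hy, mul_mem hx hy, dif_pos]
    rw [← toAdd_mul, ← map_mul]
    rfl
  · simp only [hNM hx, dif_pos]
    have : ((⟨x, hNM hx⟩ : M) : M ⧸ N') = 1 := (QuotientGroup.eq_one_iff _).mpr hx
    rw [this, map_one, toAdd_one]
  · simp only [hs, dif_pos]
    exact hf

variable [Finite G]

/-- If `w ^ p ∉ L`, then `w ^ p` generates `S` modulo `L`, so `w` centralizes `S` modulo `K`. Should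
this hold for `x`, take `y` not centralizing `S` modulo `K`. Then `y ^ p ∈ L`, and since `p`-th
powers are multiplicative modulo `L`, `(x * y) ^ p ∉ L`. Thus `x` and `x * y` both centralize `S`
modulo `K`, and so does `y`. -/
theorem pow_prime_mem_upperCentralSeries (hodd : Odd p) (hG : IsPGroup p G) {n : ℕ}
    (hcard : Nat.card (Subgroup.upperCentralSeries G (n + 2)) =
      p * Nat.card (Subgroup.upperCentralSeries G (n + 1)))
    (hcomm : ∀ x y : G, ⁅x, y⁆ ∈ Subgroup.upperCentralSeries G (n + 2))
    (hpow : ∀ x : G, x ^ p ∈ Subgroup.upperCentralSeries G (n + 2)) (x : G) :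
    x ^ p ∈ Subgroup.upperCentralSeries G (n + 1) := by
  set K := Subgroup.upperCentralSeries G n
  set L := Subgroup.upperCentralSeries G (n + 1)
  set S := Subgroup.upperCentralSeries G (n + 2)
  have hLS : L ≤ S := Subgroup.upperCentralSeries_mono G (Nat.le_succ _)
  have hSp : ∀ s ∈ S, s ^ p ∈ L := fun s hs => by
    have h1 := Subgroup.relIndex_mul_relIndex ⊥ L S bot_le hLS
    rw [Subgroup.relIndex_bot_left, Subgroup.relIndex_bot_left, hcard, mul_comm] at h1
    have h2 : (L.subgroupOf S).index = p := Nat.eq_of_mul_eq_mul_right Nat.card_pos h1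
    have h3 := (L.subgroupOf S).pow_index_mem (⟨s, hs⟩ : S)
    rw [h2] at h3
    exact h3
  have hmul : ∀ x y : G, ((x * y : G) ^ p : G ⧸ L) = (x : G ⧸ L) ^ p * (y : G ⧸ L) ^ p :=
    fun x y => by
      rw [QuotientGroup.mk_mul]
      refine mul_pow_prime_of_class_two hp.out hodd ?_ ?_ _ _
      · intro x y
        obtain ⟨x, rfl⟩ := QuotientGroup.mk_surjective x
        obtain ⟨y, rfl⟩ := QuotientGroup.mk_surjective y
        exact (centerMod_upperCentralSeries (G := G) (n + 1)).ge (hcomm x y)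
      · intro x y
        obtain ⟨x, rfl⟩ := QuotientGroup.mk_surjective x
        obtain ⟨y, rfl⟩ := QuotientGroup.mk_surjective y
        exact (QuotientGroup.eq_one_iff _).mpr (hSp _ (hcomm x y))
  have hS' : ∀ w : G, w ^ p ∉ L → ∀ s ∈ S, Commute (s : G ⧸ K) (w : G ⧸ K) := fun w hw s hs => by
    obtain ⟨k, l, hl, rfl⟩ := exists_zpow_mul_of_card_le hG hLS hcard.le (hpow w) hw hs
    rw [QuotientGroup.mk_mul, QuotientGroup.mk_zpow, QuotientGroup.mk_pow]
    refine Commute.mul_left (((Commute.refl _).pow_left p).zpow_left k) ?_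
    exact commutator_mem_iff_commute_mk.mp
      (mem_upperCentralSeries_succ_iff_commutatorElement.mp hl w)
  by_contra hx
  obtain ⟨s, hs, y, hy⟩ : ∃ s ∈ S, ∃ y : G, ¬ Commute (s : G ⧸ K) (y : G ⧸ K) := by
    by_contra! hall
    have hSL : S ≤ L := fun s hs => mem_upperCentralSeries_succ_iff_commutatorElement.mpr
      fun y => commutator_mem_iff_commute_mk.mpr (hall s hs y)
    have h1 := Subgroup.card_le_of_le hSL
    rw [hcard] at h1
    have h2 : 0 < Nat.card L := Nat.card_pos
    have h3 := hp.out.one_lt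
    nlinarith
  have hyL : y ^ p ∈ L := by
    by_contra hyL
    exact hy (hS' y hyL s hs)
  have hxy : (x * y) ^ p ∉ L := fun h => by
    apply hx
    rw [← QuotientGroup.eq_one_iff] at h hyL ⊢
    rw [QuotientGroup.mk_pow] at h hyL ⊢
    rw [hmul, hyL, mul_one] at h
    exact h
  have h1 := hS' _ hxy s hs
  have h2 := hS' x hx s hs
  apply hy
  have h3 := h2.inv_right.mul_right h1
  rwa [QuotientGroup.mk_mul, inv_mul_cancel_left] at h3

end LargeClass

/-! ### Class at least four, and the assembly of cases -/

section Main

/-- The second derivation is `v ^ τ * z ^ θ` on `M = ker χ`, with `θ` a functional on `M ⧸ L`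
nonzero on `S`, and `τ m = θ (b⁻¹ * m * b) - θ m`. Since `b⁻¹ * v * b = v * z`, this `τ` is exactly
what makes it commute with conjugation by `b`. Class at least four ensures that `v` lies in `L` and
that the third center has order `p` over the second. -/
theorem exists_not_isInnerAut_of_class_ge_four {G : Type*} [Group G] [Finite G] {p : ℕ}
    [hp : Fact p.Prime] (hodd : Odd p) {l : ℕ} (hcard : Nat.card G = p ^ (l + 6))
    (hclass : Group.nilpotencyClass G = l + 4) :
    ∃ φ : MulAut G, orderOf φ = p ∧ ¬ IsInnerAut φ := by
  by_contra! hinn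
  obtain ⟨-, h2, -⟩ := card_upperCentralSeries_of_coclass_two (m := l + 1) hcard hclass hinn
  obtain ⟨z, v, a, χ, hz, hzc, hvp, hv2, hvc, hχ, hχv, ha, hχS⟩ :=
    exists_character_data_of_coclass_two (m := l + 1) hodd hcard hclass hinn
  have hG : IsPGroup p G := IsPGroup.of_card hcard
  have hnil : Group.IsNilpotent G := hG.isNilpotent
  have hzp : z ^ p = 1 := hz ▸ pow_orderOf_eq_one z
  have hp0 : 0 < p := hp.out.pos
  set L := Subgroup.upperCentralSeries G (l + 2)
  set S := Subgroup.upperCentralSeries G (l + 3) with hSdef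
  have hLcard : Nat.card L = p ^ (l + 3) := h2 (l + 2) (by omega) (by omega)
  have hScard : Nat.card S = p ^ (l + 4) := h2 (l + 3) (by omega) (by omega)
  have hLS : L ≤ S := Subgroup.upperCentralSeries_mono G (Nat.le_succ _)
  have hSL : ∀ s ∈ S, ∀ y, ⁅s, y⁆ ∈ L := fun s hs =>
    mem_upperCentralSeries_succ_iff_commutatorElement.mp hs
  have hStop : S ≠ ⊤ := fun h => by
    rw [hSdef, Subgroup.upperCentralSeries_eq_top_iff_nilpotencyClass_le, hclass] at h
    omega
  have hcommS : ∀ x y : G, ⁅x, y⁆ ∈ S := fun x => by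
    refine mem_upperCentralSeries_succ_iff_commutatorElement.mp ?_
    have : Subgroup.upperCentralSeries G (l + 3 + 1) = ⊤ :=
      Subgroup.upperCentralSeries_eq_top_iff_nilpotencyClass_le.mpr hclass.le
    rw [this]
    exact Subgroup.mem_top x
  have hpowS : ∀ x : G, x ^ p ∈ S := by
    refine pow_mem_of_index_eq_prime_sq ?_ ?_
    · have h := S.card_mul_index
      rw [hScard, hcard, show l + 6 = l + 4 + 2 from rfl, pow_add p (l + 4)] at h
      exact Nat.eq_of_mul_eq_mul_left (pow_pos hp0 _) h
    · have hLS' : centerMod L = S := centerMod_upperCentralSeries (l + 2)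
      have h := exists_ne_zpow_mul_of_centerMod_ne_top (N := L) (hLS' ▸ hStop)
      rwa [hLS'] at h
  have hpowL : ∀ x : G, x ^ p ∈ L :=
    pow_prime_mem_upperCentralSeries hodd hG (n := l + 1)
      (by rw [h2 _ (by omega) (by omega), h2 _ (by omega) (by omega)]; ring) hcommS hpowS
  have hvL : v ∈ L := Subgroup.upperCentralSeries_mono G (by omega : 2 ≤ l + 2) hv2
  have hzL : z ∈ L := by
    refine Subgroup.upperCentralSeries_mono G (by omega : 1 ≤ l + 2) ?_
    rwa [Subgroup.upperCentralSeries_one]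
  have hcent : ∀ (i : ZMod p) g, Commute (modPow z i) g := fun i g =>
    commute_modPow (Subgroup.mem_center_iff.mp hzc g).symm i
  have hχne := exists_character_ne_zero hz hχv hvc
  obtain ⟨b, hb⟩ := exists_character_eq_one hχ hχne
  -- The kernel `M` of `χ` is elementary abelian modulo `L`.
  let f : G →* Multiplicative (ZMod p) := MonoidHom.mk' (fun x => Multiplicative.ofAdd (χ x))
    fun x y => by rw [hχ, ofAdd_add]
  let M : Subgroup G := f.ker
  have hM : ∀ {x}, x ∈ M ↔ χ x = 0 := Iff.rfl
  have hSM : S ≤ M := fun x hx => hM.mpr (hχS x hx)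
  have hMcard : Nat.card M ≤ p * Nat.card S := by
    have hlt : M < ⊤ := lt_top_iff_ne_top.mpr fun h => by
      obtain ⟨x, hx⟩ := hχne
      exact hx (hM.mp (h ▸ Subgroup.mem_top x))
    have h := mul_card_le_card_of_lt hG hlt
    rw [Subgroup.card_top, hcard, pow_succ'] at h
    rw [hScard, ← pow_succ']
    exact Nat.le_of_mul_le_mul_left h hp0
  have hMcomm : ∀ x ∈ M, ∀ y ∈ M, ⁅x, y⁆ ∈ L := by
    have h := commutator_mem_of_card_centerMod (hG.to_subgroup M) (N := L.subgroupOf M) <| by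
      refine hMcard.trans (Nat.mul_le_mul_left p ?_)
      let F : S → centerMod (L.subgroupOf M) := fun s =>
        ⟨⟨s, hSM s.2⟩, mem_centerMod_iff.mpr fun y => hSL s s.2 y⟩
      refine Nat.card_le_card_of_injective F fun s t h => ?_
      exact Subtype.ext (congrArg (fun u : centerMod (L.subgroupOf M) => ((u : M) : G)) h)
    exact fun x hx y hy => h ⟨x, hx⟩ ⟨y, hy⟩
  obtain ⟨s, hs, hsL⟩ : ∃ s ∈ S, s ∉ L := by
    by_contra! hall
    have h := Subgroup.card_le_of_le hall
    rw [hScard, hLcard, Nat.pow_le_pow_iff_right hp.out.one_lt] at h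
    omega
  obtain ⟨θ, hθ, hθL, hθs⟩ :=
    exists_partial_hom_apply_ne_zero (hLS.trans hSM) hMcomm (fun x _ => hpowL x) (hSM hs) hsL
  have hθpow : ∀ x ∈ M, ∀ n : ℕ, θ (x ^ n) = n * θ x := by
    intro x hx n
    induction n with
    | zero => simpa using hθL 1 (one_mem _)
    | succ n ih => rw [pow_succ, hθ _ (pow_mem hx n) _ hx, ih]; push_cast; ring
  have hθS : ∀ t ∈ S, θ t = 0 → t ∈ L := by
    intro t ht h0
    by_contra htL
    obtain ⟨k, n, hn, rfl⟩ := exists_zpow_mul_of_card_le hG hLS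
      (by rw [hScard, hLcard, ← pow_succ']) ht htL hs
    apply hθs
    have htM := hSM ht
    rw [hθ _ (M.zpow_mem htM k) _ (hSM (hLS hn)), hθL n hn, add_zero]
    obtain ⟨k, rfl | rfl⟩ := k.eq_nat_or_neg
    · rw [zpow_natCast, hθpow t htM, h0, mul_zero]
    · have h3 := hθ _ (M.zpow_mem htM (-(k : ℤ))) _ (pow_mem htM k)
      rw [hθpow t htM, h0, mul_zero, add_zero, zpow_neg, zpow_natCast, inv_mul_cancel,
        hθL 1 (one_mem _)] at h3
      rw [zpow_neg, zpow_natCast, ← h3]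
  have hconjM : ∀ m ∈ M, b⁻¹ * m * b ∈ M := fun m hm => by
    have : M.Normal := MonoidHom.normal_ker f
    simpa using this.conj_mem m hm b⁻¹
  have hconjL : ∀ x ∈ L, b⁻¹ * x * b ∈ L := fun x hx => by
    have : L.Normal := inferInstance
    simpa using this.conj_mem x hx b⁻¹
  let τ : G → ZMod p := fun m => θ (b⁻¹ * m * b) - θ m
  have hτdef : ∀ m, θ (b⁻¹ * m * b) = θ m + τ m := fun m => by simp [τ]
  have hτ : ∀ m ∈ M, ∀ n ∈ M, τ (m * n) = τ m + τ n := fun m hm n hn => by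
    have e : b⁻¹ * (m * n) * b = (b⁻¹ * m * b) * (b⁻¹ * n * b) := by group
    simp only [τ]
    rw [e, hθ _ (hconjM m hm) _ (hconjM n hn), hθ m hm n hn]
    ring
  have hτL : ∀ x ∈ L, τ x = 0 := fun x hx => by
    simp only [τ]
    rw [hθL _ (hconjL x hx), hθL x hx, sub_zero]
  have hτS : ∀ x ∈ S, τ x = 0 := fun x hx => by
    have h : ⁅x⁻¹, b⁻¹⁆ ∈ L := hSL _ (inv_mem hx) _
    have e : b⁻¹ * x * b = x * ⁅x⁻¹, b⁻¹⁆ := by rw [commutatorElement_def]; group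
    simp only [τ]
    rw [e, hθ _ (hSM hx) _ (hSM (hLS h)), hθL _ h]
    ring
  have hτconj : ∀ m ∈ M, τ (b⁻¹ * m * b) = τ m := fun m hm => by
    have e : b⁻¹ * m * b = m * ⁅m⁻¹, b⁻¹⁆ := by rw [commutatorElement_def]; group
    have h := hcommS m⁻¹ b⁻¹
    rw [e, hτ _ hm _ (hSM h), hτS _ h, add_zero]
  -- If `τ` vanished on `M`, then `b` would commute with `M` modulo `L`, and `G ⧸ L` would be
  -- abelian, contradicting `S ≠ ⊤`.
  obtain ⟨m₀, hm₀, hτm₀⟩ : ∃ m ∈ M, τ m ≠ 0 := by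
    by_contra! hall
    have hbM : ∀ m ∈ M, ⁅b, m⁆ ∈ L := fun m hm => by
      rw [commutator_mem_iff_commute_mk]
      have h : ⁅m⁻¹, b⁻¹⁆ ∈ L := by
        have hS' := hcommS m⁻¹ b⁻¹
        refine hθS _ hS' ?_
        have e : b⁻¹ * m * b = m * ⁅m⁻¹, b⁻¹⁆ := by rw [commutatorElement_def]; group
        have h3 := hτdef m
        rw [hall m hm, e, hθ _ hm _ (hSM hS'), add_zero] at h3
        simpa using h3
      rw [commutator_mem_iff_commute_mk, QuotientGroup.mk_inv, QuotientGroup.mk_inv] at h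
      exact (Commute.inv_inv_iff.mp h).symm
    have hdec : ∀ g, ∃ (k : ℕ), ∃ m ∈ M, g = b ^ k * m := fun g => by
      refine ⟨(χ g).val, (b ^ (χ g).val)⁻¹ * g, ?_, by group⟩
      have hfb : ∀ x, f x = Multiplicative.ofAdd (χ x) := fun _ => rfl
      rw [MonoidHom.mem_ker, map_mul, map_inv, map_pow, hfb, hfb, hb, ← ofAdd_nsmul,
        nsmul_eq_mul, mul_one, ZMod.natCast_zmod_val, inv_mul_cancel]
    have hbS : ∀ g, ⁅b, g⁆ ∈ L := fun g => by
      obtain ⟨k, m, hm, rfl⟩ := hdec g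
      rw [commutator_mem_iff_commute_mk, QuotientGroup.mk_mul, QuotientGroup.mk_pow]
      exact ((Commute.refl _).pow_right k).mul_right
        (commutator_mem_iff_commute_mk.mp (hbM m hm))
    have hMS : ∀ m ∈ M, ∀ g, ⁅m, g⁆ ∈ L := fun m hm g => by
      obtain ⟨k, n, hn, rfl⟩ := hdec g
      rw [commutator_mem_iff_commute_mk, QuotientGroup.mk_mul, QuotientGroup.mk_pow]
      exact ((commutator_mem_iff_commute_mk.mp (hbM m hm)).symm.pow_right k).mul_right
        (commutator_mem_iff_commute_mk.mp (hMcomm m hm n hn))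
    refine hStop ((Subgroup.eq_top_iff' _).mpr fun g => ?_)
    obtain ⟨k, m, hm, rfl⟩ := hdec g
    exact mul_mem (pow_mem (mem_upperCentralSeries_succ_iff_commutatorElement.mpr hbS) k)
      (mem_upperCentralSeries_succ_iff_commutatorElement.mpr (hMS m hm))
  -- The derivation on `M` with exponents `τ` and `θ`, extended to `G`.
  let η : G → G := fun m => modPow v (τ m) * modPow z (θ m)
  have hηL : ∀ m, η m ∈ L := fun m => mul_mem (modPow_mem hvL _) (modPow_mem hzL _)
  have hηker : ∀ x ∈ L, η x = 1 := fun x hx => by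
    simp only [η]
    rw [hτL x hx, hθL x hx, modPow_zero, modPow_zero, mul_one]
  obtain ⟨δ, hδM, hδη, hδ⟩ := exists_derivation_extension hχ hb (η := η)
    (fun m n hm hn => by
      simp only [η]
      rw [hτ m hm n hn, hθ m hm n hn, modPow_add hvp, modPow_add hzp, mul_assoc, mul_assoc,
        ← mul_assoc (modPow v (τ n)), ← (hcent (θ m) (modPow v (τ n))).eq]
      simp only [mul_assoc])
    (fun m n _ hn => (commute_modPow ((character_eq_zero_iff hz hχv).mp hn) _).mul_left
      (hcent _ n))
    (fun m hm => by
      simp only [η]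
      have e : b⁻¹ * (modPow v (τ m) * modPow z (θ m)) * b =
          b⁻¹ * modPow v (τ m) * b * modPow z (θ m) := by
        rw [mul_assoc, mul_assoc, (hcent _ b).eq]; group
      rw [hτconj m hm, hτdef, e, conj_modPow, hχv, hb, modPow_one,
        modPow_mul_base (Subgroup.mem_center_iff.mp hzc v), add_comm, modPow_add hzp, mul_assoc])
    (hηker _ (hpowL b))
  have hδL : ∀ g, δ g ∈ L := fun g => by
    obtain ⟨m, -, h⟩ := hδη g
    rw [h]; exact hηL m
  have hδker : ∀ x ∈ L, δ x = 1 := fun x hx => by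
    rw [hδM x (hχS x (hLS hx)), hηker x hx]
  have hδm₀ : δ m₀ ∉ Subgroup.center G := fun h => by
    rw [hδM m₀ hm₀] at h
    have h3 := (Subgroup.mul_mem_cancel_right _ (modPow_mem hzc (θ m₀))).mp h
    exact hvc (mem_of_modPow_mem hvp hτm₀ h3)
  obtain ⟨c, hc⟩ := exists_conj_of_derivation hp.out hinn δ hδ (fun g => hδker _ (hδL g))
    (fun g => by
      obtain ⟨m, -, h⟩ := hδη g
      rw [h, (hcent _ _).symm.mul_pow, modPow_pow hvp, modPow_pow hzp, mul_one])
    ⟨m₀, fun h => hδm₀ (h ▸ one_mem _)⟩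
  -- Both conjugating elements lie in the third center, which is cyclic modulo the second.
  have hvz : ∀ i j : ZMod p, modPow v i * modPow z j ∈ Subgroup.upperCentralSeries G 2 := by
    have hz2 : z ∈ Subgroup.upperCentralSeries G 2 := by
      refine Subgroup.upperCentralSeries_mono G one_le_two ?_
      rwa [Subgroup.upperCentralSeries_one]
    exact fun i j => mul_mem (modPow_mem hv2 _) (modPow_mem hz2 _)
  have hN2 : (Subgroup.upperCentralSeries G 2).Normal := inferInstance
  have ha3 : a ∈ Subgroup.upperCentralSeries G 3 :=
    mem_upperCentralSeries_succ_iff_commutatorElement.mpr fun y => by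
      rw [commutatorElement_def, ha]
      exact hN2.conj_mem _ (hvz _ _) y
  have hc3 : c ∈ Subgroup.upperCentralSeries G 3 :=
    mem_upperCentralSeries_succ_iff_commutatorElement.mpr fun y => by
      rw [commutatorElement_def, hc]
      obtain ⟨m, -, h⟩ := hδη y
      rw [h]
      exact hN2.conj_mem _ (hvz _ _) y
  have ha2 := notMem_upperCentralSeries_two hvp hvc hzc ha hχne
  obtain ⟨k, y, hy, rfl⟩ := exists_zpow_mul_of_card_le hG
    (Subgroup.upperCentralSeries_mono G (by omega : 2 ≤ 3))
    (by rw [h2 3 (by omega) (by omega), h2 2 (by omega) (by omega), ← pow_succ']) ha3 ha2 hc3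
  -- Since `χ m₀ = 0`, the factor `a ^ k` of the conjugating element does not move `m₀`, so `δ m₀`
  -- comes from `y` alone and is central.
  have ham : Commute a m₀ := by
    have h := ha m₀
    rw [hM.mp hm₀] at h
    simp only [zero_mul, zero_div, modPow_zero, mul_one] at h
    exact mul_inv_eq_iff_eq_mul.mp h
  have hym : ⁅y, m₀⁆ ∈ Subgroup.center G := by
    have h := mem_upperCentralSeries_succ_iff_commutatorElement.mp hy m₀
    rwa [Subgroup.upperCentralSeries_one] at h
  apply hδm₀
  have hak : a ^ k * m₀ = m₀ * a ^ k := (ham.zpow_left k).eq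
  have e1 : a ^ k * y * m₀ * (a ^ k * y)⁻¹ = ⁅y, m₀⁆ * m₀ := by
    have e2 : a ^ k * y * m₀ * (a ^ k * y)⁻¹ = a ^ k * ⁅y, m₀⁆ * m₀ * (a ^ k)⁻¹ := by
      rw [commutatorElement_def]; group
    rw [e2, Subgroup.mem_center_iff.mp hym, mul_assoc _ (a ^ k), hak]; group
  rw [hc, ← Subgroup.mem_center_iff.mp hym, mul_right_inj] at e1
  rwa [e1]

theorem theorem5p1 (p : ℕ) (hp : p.Prime) (hodd : Odd p)
    (G : Type*) [Group G] [Finite G]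
    (hG : IsPGroup p G) (hcoclass : HasCoclass p G 2) :
    ∃ φ : MulAut G, orderOf φ = p ∧ ¬ IsInnerAut φ := by
  have : Fact p.Prime := ⟨hp⟩
  have hnil : Group.IsNilpotent G := hG.isNilpotent
  obtain ⟨n, hcard, rfl⟩ := hcoclass
  have htop : ∀ n, Group.nilpotencyClass G ≤ n ↔ Subgroup.upperCentralSeries G n = ⊤ := fun n =>
    Subgroup.upperCentralSeries_eq_top_iff_nilpotencyClass_le.symm
  obtain hc | hc | hc | ⟨l, hc⟩ : Group.nilpotencyClass G ≤ 1 ∨ Group.nilpotencyClass G = 2 ∨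
      Group.nilpotencyClass G = 3 ∨ ∃ l, Group.nilpotencyClass G = l + 4 := by
    by_cases h : Group.nilpotencyClass G < 4
    · omega
    · exact Or.inr (Or.inr (Or.inr ⟨Group.nilpotencyClass G - 4, by omega⟩))
  · refine exists_not_isInnerAut_of_comm hG ?_ ?_
    · rwa [← Subgroup.upperCentralSeries_one, ← htop]
    · rw [hcard]
      exact (lt_self_pow₀ hp.one_lt (by norm_num : 1 < 2)).trans_le
        (Nat.pow_le_pow_right hp.pos (by omega))
  · rw [hc] at hcard
    refine exists_not_isInnerAut_of_class_two hodd hcard ?_ ?_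
    · rw [← Subgroup.upperCentralSeries_one, ne_eq, ← htop]
      omega
    · intro x y
      rw [← Subgroup.upperCentralSeries_one]
      refine mem_upperCentralSeries_succ_iff_commutatorElement.mp ?_ y
      rw [(htop 2).mp hc.le]
      exact Subgroup.mem_top x
  · rw [hc] at hcard
    exact exists_not_isInnerAut_of_class_three hodd hcard hc
  · rw [hc] at hcard
    exact exists_not_isInnerAut_of_class_ge_four hodd hcard hc

end Main
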